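/- **Nonlocal Div-Curl Lemma.** Let $0<s<1\le p<\infty$, $\frac1p+\frac1{p'}=1$, and let $$W^{s,p}(\mathbb R^N)=\Big\{u\in L^p(\mathbb R^N): D_{s,p}u\in L^p(\mathbb R^N\times\mathbb R^N)\Big\},\qquad D_{s,p}u(x,y)=\frac{u(x)-u(y)}{|x-y|^{N/p+s}},$$ with norm $\|u\|_{s,p}=(\|u\|_p^p+[u]_{s,p}^p)^{1/p}$, where $[u]_{s,p}=\|D_{s,p}u\|_{L^p(\mathbb R^N\times\mathbb R^N)}$. Let $W^{-s,p'}(\mathbb R^N)$ be the dual space of $W^{s,p}(\mathbb R^N)$. For an open set $\Omega\subset\mathbb R^N$ let $W^{s,p}_0(\Omega)$ be the closure of $C_c^\infty(\Omega)$ in $W^{s,p}(\mathbb R^N)$. For $f_n,f\in W^{-s,p'}(\mathbb R^N)$ we say that $f_n\to f$ in $W^{-s,p'}_{\mathrm{loc}}(\mathbb R^N)$ if, for every bounded open $\Omega\subset\mathbb R^N$, $$\sup\{\langle f_n-f,u\rangle: u\in W^{s,p}_0(\Omega),\ [u]_{s,p}=1\}\to 0 .$$ For $\phi\in L^{p'}(\mathbb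 R^N\times\mathbb R^N)$ the $(s,p)$-divergence $$d_{s,p}\phi(x)=\mathrm{p.v.}\int_{\mathbb R^N}\frac{\phi(x,y)-\phi(y,x)}{|x-y|^{N/p+s}}\,dy$$ is the element of $W^{-s,p'}(\mathbb R^N)$ given by $\langle d_{s,p}\phi,u\rangle=\lim_{\varepsilon\to0^+}\int_{\mathbb R^N}\Big(\int_{|x-y|\ge\varepsilon}\frac{\phi(x,y)-\phi(y,x)}{|x-y|^{N/p+s}}\,dy\Big)u(x)\,dx$ for $u\in W^{s,p}(\mathbb R^N)$. Let $\phi_n,\phi_0\in L^{p'}(\mathbb R^N\times\mathbb R^N)$ and $v_n,v_0\in W^{s,p}(\mathbb R^N)$ ($n\in\mathbb N$) be such that - $v_n\rightharpoonup v_0$ weakly in $W^{s,p}(\mathbb R^N)$, - $\phi_n\rightharpoonup\phi_0$ weakly in $L^{p'}(\mathbb R^N\times\mathbb R^N)$, - $d_{s,p}\phi_n\to d_{s,p}\phi_0$ in $W^{-s,p'}_{\mathrm{loc}}(\mathbb R^N)$. Then $\phi_n\,D_{s,p}v_n\to\phi_0\,D_{s,p}v_0$ in the sense of distributions on $\mathbb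 R^N\times\mathbb R^N$, that is, for every $\eta\in C_c^\infty(\mathbb R^N\times\mathbb R^N)$, $$\iint\phi_n\,D_{s,p}v_n\,\eta\,dx\,dy\;\longrightarrow\;\iint\phi_0\,D_{s,p}v_0\,\eta\,dx\,dy .$$ -/

import Mathlib

open MeasureTheory Filter Topology
open scoped ENNReal ContDiff

noncomputable section

namespace NonlocalDivCurl

/-- The Euclidean space `ℝ^N`. -/
abbrev Eu (N : ℕ) : Type := EuclideanSpace ℝ (Fin N)

/-- `L^r(ℝ^N × ℝ^N)`. -/
abbrev LpProd (N : ℕ) (r : ℝ≥0∞) : Type :=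
  Lp ℝ r (volume : Measure (Eu N × Eu N))

/-- The `(s,p)`-gradient `D_{s,p} u (x,y) = (u x - u y) / |x-y|^{N/p + s}` of a function. -/
def sgrad (N : ℕ) (s : ℝ) (p : ℝ≥0∞) (u : Eu N → ℝ) (z : Eu N × Eu N) : ℝ :=
  (u z.1 - u z.2) / ‖z.1 - z.2‖ ^ ((N : ℝ) / p.toReal + s)

theorem sgrad_congr {N : ℕ} {s : ℝ} {p : ℝ≥0∞} {u v : Eu N → ℝ} (h : u =ᵐ[volume] v) :
    sgrad N s p u =ᵐ[volume] sgrad N s p v := by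
  have h1 := (Measure.quasiMeasurePreserving_fst
    (μ := (volume : Measure (Eu N))) (ν := (volume : Measure (Eu N)))).ae_eq_comp h
  have h2 := (Measure.quasiMeasurePreserving_snd
    (μ := (volume : Measure (Eu N))) (ν := (volume : Measure (Eu N)))).ae_eq_comp h
  filter_upwards [h1, h2] with z hz1 hz2
  simp only [Function.comp_apply] at hz1 hz2
  simp only [sgrad, hz1, hz2]

theorem sgrad_add {N : ℕ} {s : ℝ} {p : ℝ≥0∞} (u v : Eu N → ℝ) :
    sgrad N s p (u + v) = sgrad N s p u + sgrad N s p v := by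
  ext z; simp only [sgrad, Pi.add_apply]; ring

theorem sgrad_smul {N : ℕ} {s : ℝ} {p : ℝ≥0∞} (c : ℝ) (u : Eu N → ℝ) :
    sgrad N s p (c • u) = c • sgrad N s p u := by
  ext z; simp only [sgrad, Pi.smul_apply, smul_eq_mul]; ring

/-- The linear subspace of those `u ∈ L^p(ℝ^N)` with `D_{s,p} u ∈ L^p(ℝ^N × ℝ^N)`. -/
def sobolevSubmodule (N : ℕ) (s : ℝ) (p : ℝ≥0∞) :
    Submodule ℝ (Lp ℝ p (volume : Measure (Eu N))) where
  carrier := {u | MemLp (sgrad N s p u) p volume}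
  zero_mem' := by
    have h : sgrad N s p (0 : Eu N → ℝ) = 0 := by ext z; simp [sgrad]
    refine (memLp_congr_ae (sgrad_congr (Lp.coeFn_zero ℝ p volume))).2 ?_
    rw [h]; exact MemLp.zero
  add_mem' := by
    intro u v hu hv
    refine (memLp_congr_ae (sgrad_congr (Lp.coeFn_add u v))).2 ?_
    rw [sgrad_add]; exact MemLp.add hu hv
  smul_mem' := by
    intro c u hu
    refine (memLp_congr_ae (sgrad_congr (Lp.coeFn_smul c u))).2 ?_
    rw [sgrad_smul]; exact MemLp.const_smul hu c

/-- The fractional Sobolev space `W^{s,p}(ℝ^N)`. It is a type of its own, because its norm is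
`(‖u‖_p^p + [u]_{s,p}^p)^{1/p}` and not the `L^p` norm of the ambient space. -/
def Sobolev (N : ℕ) (s : ℝ) (p : ℝ≥0∞) : Type := sobolevSubmodule N s p

instance (N : ℕ) (s : ℝ) (p : ℝ≥0∞) : AddCommGroup (Sobolev N s p) :=
  inferInstanceAs (AddCommGroup (sobolevSubmodule N s p))

instance (N : ℕ) (s : ℝ) (p : ℝ≥0∞) : Module ℝ (Sobolev N s p) :=
  inferInstanceAs (Module ℝ (sobolevSubmodule N s p))

/-- The inclusion `W^{s,p}(ℝ^N) → L^p(ℝ^N)`. -/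
def Sobolev.toLp {N : ℕ} {s : ℝ} {p : ℝ≥0∞} :
    Sobolev N s p →ₗ[ℝ] Lp ℝ p (volume : Measure (Eu N)) :=
  (sobolevSubmodule N s p).subtype

theorem Sobolev.memLp_sgrad {N : ℕ} {s : ℝ} {p : ℝ≥0∞} (u : Sobolev N s p) :
    MemLp (sgrad N s p (Sobolev.toLp u)) p volume :=
  Subtype.property (p := fun v => v ∈ sobolevSubmodule N s p) u

/-- The `(s,p)`-gradient as a linear map `W^{s,p}(ℝ^N) → L^p(ℝ^N × ℝ^N)`. -/
def Sobolev.D {N : ℕ} {s : ℝ} {p : ℝ≥0∞} : Sobolev N s p →ₗ[ℝ] LpProd N p where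
  toFun u := MemLp.toLp (sgrad N s p (Sobolev.toLp u)) (Sobolev.memLp_sgrad u)
  map_add' u v := by
    rw [← MemLp.toLp_add]
    refine MemLp.toLp_congr _ _ ?_
    rw [← sgrad_add]
    exact sgrad_congr (Lp.coeFn_add (Sobolev.toLp u) (Sobolev.toLp v))
  map_smul' c u := by
    rw [RingHom.id_apply, ← MemLp.toLp_const_smul]
    refine MemLp.toLp_congr _ _ ?_
    rw [← sgrad_smul]
    exact sgrad_congr (Lp.coeFn_smul c (Sobolev.toLp u))

theorem Sobolev.coeFn_D {N : ℕ} {s : ℝ} {p : ℝ≥0∞} (u : Sobolev N s p) :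
    (Sobolev.D u : Eu N × Eu N → ℝ) =ᵐ[volume] sgrad N s p (Sobolev.toLp u) :=
  MemLp.coeFn_toLp (Sobolev.memLp_sgrad u)

theorem Sobolev.toLp_injective {N : ℕ} {s : ℝ} {p : ℝ≥0∞} :
    Function.Injective (Sobolev.toLp : Sobolev N s p → _) :=
  Subtype.val_injective

/-- The Gagliardo seminorm `[u]_{s,p}`, that is the `L^p` norm of `D_{s,p} u`. -/
def Sobolev.gagliardo {N : ℕ} {s : ℝ} {p : ℝ≥0∞} (u : Sobolev N s p) : ℝ :=
  ‖Sobolev.D u‖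

/-- The embedding `u ↦ (u, D_{s,p} u)` into the `ℓ^p`-product of `L^p(ℝ^N)` and
`L^p(ℝ^N × ℝ^N)`, which is used to norm `W^{s,p}(ℝ^N)`. -/
def Sobolev.graph {N : ℕ} {s : ℝ} {p : ℝ≥0∞} :
    Sobolev N s p →ₗ[ℝ] WithLp p (Lp ℝ p (volume : Measure (Eu N)) × LpProd N p) :=
  (WithLp.linearEquiv p ℝ _).symm.toLinearMap ∘ₗ (Sobolev.toLp.prod Sobolev.D)

theorem Sobolev.graph_injective {N : ℕ} {s : ℝ} {p : ℝ≥0∞} :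
    Function.Injective (Sobolev.graph : Sobolev N s p → _) := by
  intro u v h
  apply Sobolev.toLp_injective
  exact congrArg (fun w => w.fst) h

instance (N : ℕ) (s : ℝ) (p : ℝ≥0∞) [Fact (1 ≤ p)] : NormedAddCommGroup (Sobolev N s p) :=
  NormedAddCommGroup.induced (Sobolev N s p) _ Sobolev.graph Sobolev.graph_injective

instance (N : ℕ) (s : ℝ) (p : ℝ≥0∞) [Fact (1 ≤ p)] : NormedSpace ℝ (Sobolev N s p) :=
  NormedSpace.induced ℝ (Sobolev N s p) _ Sobolev.graph

theorem Sobolev.norm_eq {N : ℕ} {s : ℝ} {p : ℝ≥0∞} [Fact (1 ≤ p)] (hp : p ≠ ⊤)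
    (u : Sobolev N s p) :
    ‖u‖ = (‖Sobolev.toLp u‖ ^ p.toReal + u.gagliardo ^ p.toReal) ^ (1 / p.toReal) :=
  WithLp.prod_norm_eq_add
    (ENNReal.toReal_pos (zero_lt_one.trans_le Fact.out).ne' hp) (Sobolev.graph u)

theorem Sobolev.gagliardo_le {N : ℕ} {s : ℝ} {p : ℝ≥0∞} [Fact (1 ≤ p)]
    (u : Sobolev N s p) : ‖Sobolev.D u‖ ≤ ‖u‖ :=
  WithLp.norm_snd_le (x := Sobolev.graph u)

/-- The dual space `W^{-s,p'}(ℝ^N)` of `W^{s,p}(ℝ^N)`. -/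
abbrev SobolevDual (N : ℕ) (s : ℝ) (p : ℝ≥0∞) [Fact (1 ≤ p)] : Type :=
  StrongDual ℝ (Sobolev N s p)

/-- `W^{s,p}_0(Ω)`: the closure of `C_c^∞(Ω)` in `W^{s,p}(ℝ^N)`. -/
def sobolevZero {N : ℕ} {s : ℝ} {p : ℝ≥0∞} [Fact (1 ≤ p)] (Ω : Set (Eu N)) :
    Set (Sobolev N s p) :=
  closure {u | ∃ g : Eu N → ℝ, ContDiff ℝ ∞ g ∧ HasCompactSupport g ∧ tsupport g ⊆ Ω ∧
    (Sobolev.toLp u : Eu N → ℝ) =ᵐ[volume] g}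

/-- The norm `‖f‖_{-s,p',Ω} = sup {⟨f, u⟩ : u ∈ W^{s,p}_0(Ω), [u]_{s,p} = 1}`, with values in
`[0, ∞]`. -/
def dualNormOn {N : ℕ} {s : ℝ} {p : ℝ≥0∞} [Fact (1 ≤ p)] (Ω : Set (Eu N))
    (f : SobolevDual N s p) : ℝ≥0∞ :=
  ⨆ (u : Sobolev N s p) (_ : u ∈ sobolevZero Ω) (_ : u.gagliardo = 1), ENNReal.ofReal (f u)

/-- Convergence `f_n → f` in `W^{-s,p'}_loc(ℝ^N)`. -/
def TendstoDualLoc {N : ℕ} {s : ℝ} {p : ℝ≥0∞} [Fact (1 ≤ p)]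
    (f : ℕ → SobolevDual N s p) (f₀ : SobolevDual N s p) : Prop :=
  ∀ Ω : Set (Eu N), IsOpen Ω → Bornology.IsBounded Ω →
    Tendsto (fun n => dualNormOn Ω (f n - f₀)) atTop (𝓝 0)

/-- The truncated `(s,p)`-divergence
`d^ε φ (x) = ∫_{|x-y| ≥ ε} (φ(x,y) - φ(y,x)) / |x-y|^{N/p + s} dy`. -/
def truncDiv (N : ℕ) (s : ℝ) (p : ℝ≥0∞) (ε : ℝ) (φ : Eu N × Eu N → ℝ) (x : Eu N) : ℝ :=
  ∫ y in {y : Eu N | ε ≤ ‖x - y‖},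
    (φ (x, y) - φ (y, x)) / ‖x - y‖ ^ ((N : ℝ) / p.toReal + s)

/-- The truncated kernel `|w|^{-(N/p+s)}` on `|w| ≥ ε`. -/
def truncKernel (N : ℕ) (s : ℝ) (p : ℝ≥0∞) (ε : ℝ) : Eu N → ℝ :=
  Set.indicator {w : Eu N | ε ≤ ‖w‖} (fun w => (‖w‖ ^ ((N : ℝ) / p.toReal + s))⁻¹)

theorem measurable_truncKernel (N : ℕ) (s : ℝ) (p : ℝ≥0∞) (ε : ℝ) :
    Measurable (truncKernel N s p ε) := by
  unfold truncKernel
  refine Measurable.indicator (by fun_prop) ?_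
  exact measurableSet_le measurable_const measurable_norm

theorem memLp_truncKernel {N : ℕ} {s : ℝ} {p : ℝ≥0∞} [Fact (1 ≤ p)] (hs : 0 < s) (hp : p ≠ ⊤)
    {ε : ℝ} (hε : 0 < ε) : MemLp (truncKernel N s p ε) p volume := by
  have hp1 : (1 : ℝ≥0∞) ≤ p := Fact.out
  have hp0 : p ≠ 0 := (zero_lt_one.trans_le hp1).ne'
  have hpr : 0 < p.toReal := ENNReal.toReal_pos hp0 hp
  set a : ℝ := (N : ℝ) / p.toReal + s with ha
  have ha0 : 0 < a := by positivity
  have h1 : MemLp (fun w : Eu N => (1 + ‖w‖) ^ (-a)) p volume := by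
    rw [← integrable_norm_rpow_iff (Measurable.aestronglyMeasurable (by fun_prop)) hp0 hp]
    have hap : (Module.finrank ℝ (Eu N) : ℝ) < a * p.toReal := by
      rw [finrank_euclideanSpace_fin, ha, add_mul, div_mul_cancel₀ _ hpr.ne']
      have := mul_pos hs hpr
      linarith
    refine (integrable_one_add_norm (μ := (volume : Measure (Eu N))) hap).congr (ae_of_all _ ?_)
    intro w
    have h0 : (0 : ℝ) ≤ 1 + ‖w‖ := by positivity
    simp only
    rw [Real.norm_of_nonneg (Real.rpow_nonneg h0 _), ← Real.rpow_mul h0, neg_mul]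
  refine MemLp.of_le_mul (c := (ε⁻¹ + 1) ^ a) h1
    (measurable_truncKernel N s p ε).aestronglyMeasurable (ae_of_all _ ?_)
  intro w
  have h0 : (0 : ℝ) < 1 + ‖w‖ := by positivity
  rw [Real.norm_of_nonneg (Real.rpow_nonneg h0.le _)]
  unfold truncKernel
  by_cases hw : ε ≤ ‖w‖
  · rw [Set.indicator_of_mem (by exact hw)]
    have hw0 : 0 < ‖w‖ := hε.trans_le hw
    rw [Real.norm_of_nonneg (by positivity), Real.rpow_neg h0.le, ← div_eq_mul_inv,
      le_div_iff₀ (by positivity), inv_mul_le_iff₀ (by positivity),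
      ← Real.mul_rpow (by positivity) (by positivity)]
    refine Real.rpow_le_rpow h0.le ?_ ha0.le
    have : 1 ≤ ‖w‖ * ε⁻¹ := by rwa [← div_eq_mul_inv, one_le_div hε]
    nlinarith
  · rw [Set.indicator_of_notMem (by exact hw), norm_zero]
    positivity

theorem memLp_mul_truncKernel {N : ℕ} {s : ℝ} {p : ℝ≥0∞} [Fact (1 ≤ p)] (hs : 0 < s)
    (hp : p ≠ ⊤) {ε : ℝ} (hε : 0 < ε) {u : Eu N → ℝ} (hu : MemLp u p volume) :
    MemLp (fun z : Eu N × Eu N => u z.1 * truncKernel N s p ε (z.1 - z.2)) p volume := by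
  have hp1 : (1 : ℝ≥0∞) ≤ p := Fact.out
  have hp0 : p ≠ 0 := (zero_lt_one.trans_le hp1).ne'
  have hk := memLp_truncKernel (N := N) hs hp hε
  have h1 : MemLp (fun z : Eu N × Eu N => u z.1 * truncKernel N s p ε z.2) p
      ((volume : Measure (Eu N)).prod volume) := by
    have hm : AEStronglyMeasurable (fun z : Eu N × Eu N => u z.1 * truncKernel N s p ε z.2)
        ((volume : Measure (Eu N)).prod volume) := hu.1.comp_fst.mul hk.1.comp_snd
    rw [← integrable_norm_rpow_iff hm hp0 hp]
    have i1 := (integrable_norm_rpow_iff hu.1 hp0 hp).2 hu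
    have i2 := (integrable_norm_rpow_iff hk.1 hp0 hp).2 hk
    refine (i1.mul_prod i2).congr (ae_of_all _ fun z => ?_)
    simp only [norm_mul]
    rw [Real.mul_rpow (norm_nonneg _) (norm_nonneg _)]
  have hmp : MeasurePreserving (fun z : Eu N × Eu N => (z.1, z.1 - z.2))
      ((volume : Measure (Eu N)).prod volume) ((volume : Measure (Eu N)).prod volume) := by
    have h2 := measurePreserving_prod_neg_add (volume : Measure (Eu N)) (volume : Measure (Eu N))
    have h3 : MeasurePreserving (Prod.map id Neg.neg : Eu N × Eu N → Eu N × Eu N)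
        ((volume : Measure (Eu N)).prod volume) ((volume : Measure (Eu N)).prod volume) :=
      (MeasurePreserving.id _).prod (Measure.measurePreserving_neg _)
    convert h3.comp h2 using 1
    ext z : 1
    simp [sub_eq_add_neg, add_comm]
  exact h1.comp_measurePreserving hmp

/-- Integration by parts for the truncated divergence. -/
theorem integral_truncDiv_mul {N : ℕ} {s : ℝ} {p q : ℝ≥0∞} [Fact (1 ≤ p)]
    [p.HolderConjugate q] (hs : 0 < s) (hp : p ≠ ⊤) {ε : ℝ} (hε : 0 < ε)
    {φ : Eu N × Eu N → ℝ} (hφ : MemLp φ q volume) {u : Eu N → ℝ} (hu : MemLp u p volume) :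
    ∫ x, truncDiv N s p ε φ x * u x =
      ∫ z, Set.indicator {z : Eu N × Eu N | ε ≤ ‖z.1 - z.2‖}
        (fun z => φ z * sgrad N s p u z) z := by
  set k := truncKernel N s p ε with hk
  set F : Eu N × Eu N → ℝ := fun z => u z.1 * k (z.1 - z.2) with hF
  have hFm : MemLp F p volume := memLp_mul_truncKernel hs hp hε hu
  have hsw : MeasurePreserving (Prod.swap : Eu N × Eu N → Eu N × Eu N) volume volume :=
    Measure.measurePreserving_swap
  have hφ' : MemLp (φ ∘ Prod.swap) q volume := hφ.comp_measurePreserving hsw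
  have hF' : MemLp (F ∘ Prod.swap) p volume := hFm.comp_measurePreserving hsw
  have i1 : Integrable (F * φ) volume := hFm.integrable_mul hφ
  have i2 : Integrable (F * (φ ∘ Prod.swap)) volume := hFm.integrable_mul hφ'
  have i3 : Integrable ((F ∘ Prod.swap) * φ) volume := hF'.integrable_mul hφ
  have e1 : ∀ x, truncDiv N s p ε φ x * u x =
      ∫ y, (F * φ - F * (φ ∘ Prod.swap)) (x, y) := by
    intro x
    rw [truncDiv, ← integral_indicator
      (measurableSet_le measurable_const (by fun_prop)), ← integral_mul_const]
    refine integral_congr_ae (ae_of_all _ fun y => ?_)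
    by_cases hy : ε ≤ ‖x - y‖
    · simp only [hF, hk, truncKernel, Pi.sub_apply, Pi.mul_apply, Function.comp_apply,
        Prod.swap_prod_mk, Set.indicator, Set.mem_ofPred_eq, hy, if_true]
      ring
    · simp [hF, hk, truncKernel, Set.indicator, hy]
  have e2 : ∫ z, (F * (φ ∘ Prod.swap)) z = ∫ z, ((F ∘ Prod.swap) * φ) z := by
    have := integral_prod_swap (μ := (volume : Measure (Eu N))) (ν := (volume : Measure (Eu N)))
      ((F ∘ Prod.swap) * φ)
    exact this
  calc ∫ x, truncDiv N s p ε φ x * u x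
      = ∫ x, ∫ y, (F * φ - F * (φ ∘ Prod.swap)) (x, y) :=
        integral_congr_ae (ae_of_all _ e1)
    _ = ∫ z, (F * φ - F * (φ ∘ Prod.swap)) z := (integral_prod _ (i1.sub i2)).symm
    _ = (∫ z, (F * φ) z) - ∫ z, (F * (φ ∘ Prod.swap)) z := integral_sub i1 i2
    _ = (∫ z, (F * φ) z) - ∫ z, ((F ∘ Prod.swap) * φ) z := by rw [e2]
    _ = ∫ z, ((F * φ) z - ((F ∘ Prod.swap) * φ) z) := (integral_sub i1 i3).symm
    _ = _ := by
      refine integral_congr_ae (ae_of_all _ fun z => ?_)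
      have hz' : ‖z.2 - z.1‖ = ‖z.1 - z.2‖ := norm_sub_rev _ _
      by_cases hz : ε ≤ ‖z.1 - z.2‖
      · simp only [hF, hk, truncKernel, sgrad, Pi.mul_apply, Function.comp_apply,
          Prod.fst_swap, Prod.snd_swap, Set.indicator, Set.mem_ofPred_eq, hz', hz, if_true]
        ring
      · simp [hF, hk, truncKernel, Set.indicator, hz', hz]

/-- For `φ ∈ L^{p'}(ℝ^N × ℝ^N)` the principal value defining the `(s,p)`-divergence exists as a
limit in `W^{-s,p'}(ℝ^N)` of the truncated divergences. -/
theorem exists_spDiv {N : ℕ} {s : ℝ} {p q : ℝ≥0∞} [Fact (1 ≤ p)] [Fact (1 ≤ q)]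
    [p.HolderConjugate q] (hs : 0 < s) (hp : p ≠ ⊤) (φ : LpProd N q) :
    ∃ f : SobolevDual N s p, ∀ u : Sobolev N s p,
      Tendsto (fun ε : ℝ => ∫ x, truncDiv N s p ε φ x * (Sobolev.toLp u : Eu N → ℝ) x)
        (𝓝[>] 0) (𝓝 (f u)) := by
  let Dc : Sobolev N s p →L[ℝ] LpProd N p :=
    LinearMap.mkContinuous Sobolev.D 1 (fun u => by simpa using Sobolev.gagliardo_le u)
  refine ⟨((ContinuousLinearMap.mul ℝ ℝ).lpPairing volume p q).flip φ ∘L Dc, fun u => ?_⟩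
  have hval : (((ContinuousLinearMap.mul ℝ ℝ).lpPairing volume p q).flip φ ∘L Dc) u =
      ∫ z, φ z * sgrad N s p (Sobolev.toLp u) z := by
    change (ContinuousLinearMap.mul ℝ ℝ).lpPairing volume p q (Sobolev.D u) φ = _
    rw [ContinuousLinearMap.lpPairing_eq_integral]
    refine integral_congr_ae ?_
    filter_upwards [Sobolev.coeFn_D u] with z hz
    rw [ContinuousLinearMap.mul_apply', hz, mul_comm]
  rw [hval]
  have hφ := Lp.memLp φ
  have hD := Sobolev.memLp_sgrad u
  have hI : Integrable (fun z => φ z * sgrad N s p (Sobolev.toLp u) z) volume := by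
    have := hD.integrable_mul hφ
    refine this.congr (ae_of_all _ fun z => mul_comm _ _)
  have hlim : Tendsto (fun ε : ℝ => ∫ z, Set.indicator {z : Eu N × Eu N | ε ≤ ‖z.1 - z.2‖}
        (fun z => φ z * sgrad N s p (Sobolev.toLp u) z) z) (𝓝[>] 0)
      (𝓝 (∫ z, φ z * sgrad N s p (Sobolev.toLp u) z)) := by
    refine tendsto_integral_filter_of_dominated_convergence
      (fun z => ‖φ z * sgrad N s p (Sobolev.toLp u) z‖) ?_ ?_ hI.norm ?_
    · exact Eventually.of_forall fun ε =>
        hI.aestronglyMeasurable.indicator (measurableSet_le measurable_const (by fun_prop))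
    · exact Eventually.of_forall fun ε => ae_of_all _ fun z => norm_indicator_le_norm_self _ _
    · refine ae_of_all _ fun z => tendsto_const_nhds.congr' ?_
      by_cases hz : z.1 = z.2
      · refine Eventually.of_forall fun ε => ?_
        simp [Set.indicator, sgrad, hz]
      · have hpos : 0 < ‖z.1 - z.2‖ := norm_pos_iff.2 (sub_ne_zero.2 hz)
        filter_upwards [Ioo_mem_nhdsGT hpos] with ε hε
        rw [Set.indicator_of_mem]
        exact hε.2.le
  refine hlim.congr' ?_
  filter_upwards [self_mem_nhdsWithin] with ε hε
  exact (integral_truncDiv_mul hs hp hε hφ (Lp.memLp (Sobolev.toLp u))).symm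

/-- The `(s,p)`-divergence
`d_{s,p} φ (x) = p.v. ∫ (φ(x,y) - φ(y,x)) / |x-y|^{N/p + s} dy`
of `φ ∈ L^{p'}(ℝ^N × ℝ^N)`, as an element of `W^{-s,p'}(ℝ^N)`: it is the functional with
`⟨d_{s,p} φ, u⟩ = lim_{ε → 0+} ∫ (d^ε φ) u dx` for all `u ∈ W^{s,p}(ℝ^N)`. -/
def spDiv {N : ℕ} {s : ℝ} {p q : ℝ≥0∞} [Fact (1 ≤ p)] [Fact (1 ≤ q)]
    [p.HolderConjugate q] (hs : 0 < s) (hp : p ≠ ⊤) (φ : LpProd N q) : SobolevDual N s p :=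
  (exists_spDiv hs hp φ).choose

theorem spDiv_spec {N : ℕ} {s : ℝ} {p q : ℝ≥0∞} [Fact (1 ≤ p)] [Fact (1 ≤ q)]
    [p.HolderConjugate q] (hs : 0 < s) (hp : p ≠ ⊤) (φ : LpProd N q) (u : Sobolev N s p) :
    Tendsto (fun ε : ℝ => ∫ x, truncDiv N s p ε φ x * (Sobolev.toLp u : Eu N → ℝ) x)
      (𝓝[>] 0) (𝓝 (spDiv hs hp φ u)) :=
  (exists_spDiv hs hp φ).choose_spec u

end NonlocalDivCurl

end

namespace NonlocalDivCurl

theorem enorm_integral_rpow_le {H : Type*} [MeasurableSpace H] (μ : Measure H)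
    [IsProbabilityMeasure μ] {p : ℝ} (hp : 1 ≤ p) {g : H → ℝ} (hg : AEStronglyMeasurable g μ) :
    ‖∫ h, g h ∂μ‖ₑ ^ p ≤ ∫⁻ h, ‖g h‖ₑ ^ p ∂μ := by
  have hp0 : 0 < p := by linarith
  have h1 := eLpNorm'_le_eLpNorm'_of_exponent_le (μ := μ) zero_lt_one hp hg
  have h2 : ‖∫ h, g h ∂μ‖ₑ ≤ eLpNorm' g p μ := by
    refine (enorm_integral_le_lintegral_enorm g).trans ?_
    simpa [eLpNorm'] using h1
  calc _ ≤ eLpNorm' g p μ ^ p := by gcongr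
    _ = _ := by
      rw [eLpNorm', ← ENNReal.rpow_mul, one_div, inv_mul_cancel₀ hp0.ne', ENNReal.rpow_one]

theorem one_le_toReal {p : ℝ≥0∞} (hp1 : 1 ≤ p) (hp : p ≠ ⊤) : 1 ≤ p.toReal := by
  simpa using (ENNReal.toReal_le_toReal ENNReal.one_ne_top hp).2 hp1

theorem eLpNorm_rpow_toReal {Z : Type*} [MeasurableSpace Z] {ν : Measure Z} {p : ℝ≥0∞}
    (hp1 : 1 ≤ p) (hp : p ≠ ⊤) (f : Z → ℝ) :
    eLpNorm f p ν ^ p.toReal = ∫⁻ z, ‖f z‖ₑ ^ p.toReal ∂ν := by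
  have h1 := one_le_toReal hp1 hp
  rw [eLpNorm_eq_lintegral_rpow_enorm_toReal (zero_lt_one.trans_le hp1).ne' hp, ← ENNReal.rpow_mul,
    one_div, inv_mul_cancel₀ (by linarith), ENNReal.rpow_one]

/-- An average of functions has `L^p` norm at most the `L^p` average of the norms. -/
theorem eLpNorm_integral_rpow_le {H Z : Type*} [MeasurableSpace H] [MeasurableSpace Z]
    (μ : Measure H) [IsProbabilityMeasure μ] (ν : Measure Z) [SFinite ν] {p : ℝ≥0∞}
    (hp1 : 1 ≤ p) (hp : p ≠ ⊤) {G : H → Z → ℝ} (hG : Measurable (Function.uncurry G)) :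
    eLpNorm (fun z => ∫ h, G h z ∂μ) p ν ^ p.toReal ≤
      ∫⁻ h, eLpNorm (G h) p ν ^ p.toReal ∂μ := by
  simp_rw [eLpNorm_rpow_toReal hp1 hp]
  rw [lintegral_lintegral_swap (by
    have : Measurable (Function.uncurry fun h z => ‖G h z‖ₑ ^ p.toReal) :=
      hG.enorm.pow_const _
    exact this.aemeasurable)]
  refine lintegral_mono fun z => ?_
  exact enorm_integral_rpow_le μ (one_le_toReal hp1 hp)
    (hG.comp measurable_prodMk_right).aestronglyMeasurable

/-- The uniform probability measure on the ball of radius `ε` about the origin. -/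
noncomputable def unifBall (N : ℕ) (ε : ℝ) : Measure (Eu N) :=
  ProbabilityTheory.cond volume (Metric.ball 0 ε)

theorem volume_ball_ne_zero {N : ℕ} {ε : ℝ} (hε : 0 < ε) :
    volume (Metric.ball (0 : Eu N) ε) ≠ 0 := (Metric.measure_ball_pos _ _ hε).ne'

theorem isProbabilityMeasure_unifBall {N : ℕ} {ε : ℝ} (hε : 0 < ε) :
    IsProbabilityMeasure (unifBall N ε) :=
  ProbabilityTheory.cond_isProbabilityMeasure_of_finite (volume_ball_ne_zero hε)
    measure_ball_lt_top.ne

theorem unifBall_eq (N : ℕ) (ε : ℝ) : unifBall N ε =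
    (volume (Metric.ball (0 : Eu N) ε))⁻¹ • volume.restrict (Metric.ball 0 ε) := rfl

theorem unifBall_absolutelyContinuous (N : ℕ) (ε : ℝ) :
    unifBall N ε ≪ volume := ProbabilityTheory.cond_absolutelyContinuous

theorem eLpNorm_unifBall_le {N : ℕ} {ε : ℝ} {p : ℝ≥0∞} (hp : p ≠ ⊤)
    (u : Eu N → ℝ) (hu : AEStronglyMeasurable u volume) (x : Eu N) :
    eLpNorm (fun h => u (x + h)) p (unifBall N ε) ≤
      (volume (Metric.ball (0 : Eu N) ε))⁻¹ ^ (1 / p).toReal * eLpNorm u p volume := by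
  rw [unifBall_eq, eLpNorm_smul_measure_of_ne_top hp, smul_eq_mul]
  gcongr
  refine (eLpNorm_mono_measure _ Measure.restrict_le_self).trans_eq ?_
  exact eLpNorm_comp_measurePreserving hu (measurePreserving_add_left volume x)

theorem integrable_unifBall {N : ℕ} {ε : ℝ} (hε : 0 < ε) {p : ℝ≥0∞} (hp1 : 1 ≤ p) (hp : p ≠ ⊤)
    {u : Eu N → ℝ} (hu : MemLp u p volume) (x : Eu N) :
    Integrable (fun h => u (x + h)) (unifBall N ε) := by
  have := isProbabilityMeasure_unifBall (N := N) hε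
  have hm : AEStronglyMeasurable (fun h => u (x + h)) (unifBall N ε) :=
    (hu.1.comp_measurePreserving (measurePreserving_add_left volume x)).mono_ac
      (unifBall_absolutelyContinuous N ε)
  refine MemLp.integrable hp1 ⟨hm, (eLpNorm_unifBall_le hp u hu.1 x).trans_lt ?_⟩
  refine ENNReal.mul_lt_top (ENNReal.rpow_lt_top_of_nonneg ENNReal.toReal_nonneg ?_) hu.2
  exact ENNReal.inv_ne_top.2 (volume_ball_ne_zero hε)

theorem norm_average_le {N : ℕ} {ε : ℝ} (hε : 0 < ε) {p : ℝ≥0∞} (hp1 : 1 ≤ p) (hp : p ≠ ⊤)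
    {u : Eu N → ℝ} (hu : MemLp u p volume) (x : Eu N) :
    ‖∫ h, u (x + h) ∂unifBall N ε‖ₑ ≤
      (volume (Metric.ball (0 : Eu N) ε))⁻¹ ^ (1 / p).toReal * eLpNorm u p volume := by
  have := isProbabilityMeasure_unifBall (N := N) hε
  refine le_trans ?_ (eLpNorm_unifBall_le hp u hu.1 x)
  refine (enorm_integral_le_lintegral_enorm _).trans ?_
  rw [← eLpNorm_one_eq_lintegral_enorm]
  exact eLpNorm_le_eLpNorm_of_exponent_le hp1 (integrable_unifBall hε hp1 hp hu x).1

theorem measurable_sgrad {N : ℕ} {s : ℝ} {p : ℝ≥0∞} {u : Eu N → ℝ} (hu : Measurable u) :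
    Measurable (sgrad N s p u) := by
  unfold sgrad; fun_prop

theorem lintegral_prod_eq_lintegral_add {N : ℕ} {F : Eu N × Eu N → ℝ≥0∞} (hF : Measurable F) :
    ∫⁻ z, F z = ∫⁻ h : Eu N, ∫⁻ x : Eu N, F (x, x + h) := by
  have h1 : ∫⁻ z, F z = ∫⁻ x : Eu N, ∫⁻ y : Eu N, F (x, y) :=
    lintegral_prod _ hF.aemeasurable
  have hm : Measurable (Function.uncurry fun h x : Eu N => F (x, x + h)) :=
    hF.comp (by fun_prop : Measurable fun z : Eu N × Eu N => (z.2, z.2 + z.1))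
  rw [h1]
  refine Eq.trans ?_ (lintegral_lintegral_swap hm.aemeasurable).symm
  refine lintegral_congr fun x => ?_
  exact (lintegral_add_left_eq_self (fun y => F (x, y)) x).symm

/-- Quantitative approximation of a function by its averages over small balls, in terms of its
Gagliardo seminorm. -/
theorem eLpNorm_sub_average_rpow_le {N : ℕ} {s : ℝ} (hs : 0 < s) {p : ℝ≥0∞} (hp1 : 1 ≤ p)
    (hp : p ≠ ⊤) {ε : ℝ} (hε : 0 < ε) {u : Eu N → ℝ} (hum : Measurable u)
    (hu : MemLp u p volume) :
    eLpNorm (fun x => u x - ∫ h, u (x + h) ∂unifBall N ε) p volume ^ p.toReal ≤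
      ENNReal.ofReal (ε ^ (s * p.toReal)) * (volume (Metric.ball (0 : Eu N) 1))⁻¹ *
        eLpNorm (sgrad N s p u) p volume ^ p.toReal := by
  have := isProbabilityMeasure_unifBall (N := N) hε
  have hpr := one_le_toReal hp1 hp
  set a : ℝ := (N : ℝ) / p.toReal + s with ha
  have ha0 : 0 < a := by positivity
  have hap : a * p.toReal = N + s * p.toReal := by rw [ha]; field_simp
  have e1 : (fun x => u x - ∫ h, u (x + h) ∂unifBall N ε) =
      fun x => ∫ h, (u x - u (x + h)) ∂unifBall N ε := by
    ext x
    rw [integral_sub (integrable_const _) (integrable_unifBall hε hp1 hp hu x)]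
    simp
  have hpt : ∀ x h : Eu N, h ∈ Metric.ball (0 : Eu N) ε → ‖u x - u (x + h)‖ₑ ^ p.toReal ≤
      ENNReal.ofReal (ε ^ (a * p.toReal)) * ‖sgrad N s p u (x, x + h)‖ₑ ^ p.toReal := by
    intro x h hh
    rw [Real.rpow_mul hε.le, ← ENNReal.ofReal_rpow_of_nonneg (by positivity) (by positivity),
      ← ENNReal.mul_rpow_of_nonneg _ _ (by positivity)]
    gcongr
    rw [← ofReal_norm, ← ofReal_norm, ← ENNReal.ofReal_mul (by positivity)]
    refine ENNReal.ofReal_le_ofReal ?_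
    by_cases h0 : h = 0
    · simp [h0, sgrad]
    have hn : 0 < ‖h‖ := norm_pos_iff.2 h0
    have hlt : ‖h‖ < ε := by simpa using hh
    simp only [sgrad, sub_add_cancel_left, norm_neg, norm_div]
    rw [Real.norm_of_nonneg (Real.rpow_nonneg hn.le _), ← ha, ← mul_div_assoc,
      le_div_iff₀ (by positivity), mul_comm]
    gcongr
  rw [e1]
  refine (eLpNorm_integral_rpow_le (unifBall N ε) volume hp1 hp (G := fun h x => u x - u (x + h))
    (by
      have h1 : Measurable fun z : Eu N × Eu N => u z.2 := hum.comp measurable_snd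
      have h2 : Measurable fun z : Eu N × Eu N => u (z.2 + z.1) := hum.comp (by fun_prop)
      exact h1.sub h2)).trans ?_
  have hF : Measurable fun z : Eu N × Eu N => ‖sgrad N s p u z‖ₑ ^ p.toReal :=
    (measurable_sgrad hum).enorm.pow_const _
  simp_rw [eLpNorm_rpow_toReal hp1 hp]
  rw [unifBall_eq, lintegral_smul_measure, lintegral_prod_eq_lintegral_add hF, smul_eq_mul]
  have hvol : (volume (Metric.ball (0 : Eu N) ε))⁻¹ * ENNReal.ofReal (ε ^ (a * p.toReal)) =
      ENNReal.ofReal (ε ^ (s * p.toReal)) * (volume (Metric.ball (0 : Eu N) 1))⁻¹ := by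
    rw [Measure.addHaar_ball_of_pos _ _ hε, finrank_euclideanSpace_fin, hap, Real.rpow_add hε,
      Real.rpow_natCast, ENNReal.ofReal_mul (by positivity),
      ENNReal.mul_inv (Or.inr measure_ball_lt_top.ne) (Or.inl ENNReal.ofReal_ne_top)]
    have h0 : ENNReal.ofReal (ε ^ N) ≠ 0 := by
      simp only [ne_eq, ENNReal.ofReal_eq_zero, not_le]; positivity
    calc _ = ((ENNReal.ofReal (ε ^ N))⁻¹ * ENNReal.ofReal (ε ^ N)) *
          (ENNReal.ofReal (ε ^ (s * p.toReal)) * (volume (Metric.ball (0 : Eu N) 1))⁻¹) := by ring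
      _ = _ := by rw [ENNReal.inv_mul_cancel h0 ENNReal.ofReal_ne_top, one_mul]
  rw [← hvol, mul_assoc]
  gcongr
  calc _ ≤ ∫⁻ h in Metric.ball (0 : Eu N) ε, ∫⁻ x : Eu N, ENNReal.ofReal (ε ^ (a * p.toReal)) *
        ‖sgrad N s p u (x, x + h)‖ₑ ^ p.toReal :=
        setLIntegral_mono' Metric.isOpen_ball.measurableSet fun h hh =>
          lintegral_mono fun x => hpt x h hh
    _ ≤ ∫⁻ h : Eu N, ∫⁻ x : Eu N, ENNReal.ofReal (ε ^ (a * p.toReal)) *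
        ‖sgrad N s p u (x, x + h)‖ₑ ^ p.toReal := setLIntegral_le_lintegral _ _
    _ = _ := by
      simp_rw [lintegral_const_mul' _ _ ENNReal.ofReal_ne_top]

/-- The average over a ball, as a continuous functional on `L^p`. -/
theorem exists_clm_average {N : ℕ} {ε : ℝ} (hε : 0 < ε) {p : ℝ≥0∞} [Fact (1 ≤ p)] (hp : p ≠ ⊤)
    (x : Eu N) : ∃ T : Lp ℝ p (volume : Measure (Eu N)) →L[ℝ] ℝ,
      ∀ u, T u = ∫ h, u (x + h) ∂unifBall N ε := by
  have hp1 : (1 : ℝ≥0∞) ≤ p := Fact.out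
  have hac : ∀ {f g : Eu N → ℝ}, f =ᵐ[volume] g →
      (fun h => f (x + h)) =ᵐ[unifBall N ε] fun h => g (x + h) := fun hfg =>
    (unifBall_absolutelyContinuous N ε).ae_le
      ((measurePreserving_add_left volume x).quasiMeasurePreserving.ae_eq_comp hfg)
  set c := (volume (Metric.ball (0 : Eu N) ε))⁻¹ ^ (1 / p).toReal with hc
  have hcf : c ≠ ⊤ := (ENNReal.rpow_lt_top_of_nonneg ENNReal.toReal_nonneg
    (ENNReal.inv_ne_top.2 (volume_ball_ne_zero hε))).ne
  refine ⟨LinearMap.mkContinuous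
    { toFun := fun u => ∫ h, u (x + h) ∂unifBall N ε
      map_add' := fun u v => ?_
      map_smul' := fun c u => ?_ } c.toReal fun u => ?_, fun u => rfl⟩
  · rw [← integral_add (integrable_unifBall hε hp1 hp (Lp.memLp u) x)
      (integrable_unifBall hε hp1 hp (Lp.memLp v) x)]
    exact integral_congr_ae (hac (Lp.coeFn_add u v))
  · rw [RingHom.id_apply, smul_eq_mul, ← integral_const_mul]
    exact integral_congr_ae (hac (Lp.coeFn_smul c u))
  · have := norm_average_le hε hp1 hp (Lp.memLp u) x
    have h2 := ENNReal.toReal_mono (ENNReal.mul_ne_top hcf (Lp.memLp u).2.ne) this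
    rw [toReal_enorm, ENNReal.toReal_mul] at h2
    exact h2

theorem tendsto_dual_of_tendsto_weak {E : Type*} [NormedAddCommGroup E] [NormedSpace ℝ E]
    {x : ℕ → E} {x₀ : E}
    (h : Tendsto (fun n => toWeakSpace ℝ E (x n)) atTop (𝓝 (toWeakSpace ℝ E x₀)))
    (f : StrongDual ℝ E) : Tendsto (fun n => f (x n)) atTop (𝓝 (f x₀)) :=
  ((WeakBilin.eval_continuous (topDualPairing ℝ E).flip f).tendsto (toWeakSpace ℝ E x₀)).comp h

/-- A weakly convergent sequence is bounded. -/
theorem exists_norm_le_of_tendsto_dual {E : Type*} [NormedAddCommGroup E] [NormedSpace ℝ E]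
    {x : ℕ → E} {x₀ : E} (h : ∀ f : StrongDual ℝ E, Tendsto (fun n => f (x n)) atTop (𝓝 (f x₀))) :
    ∃ M, ∀ n, ‖x n‖ ≤ M := by
  obtain ⟨M, hM⟩ := banach_steinhaus (g := fun n => NormedSpace.inclusionInDoubleDual ℝ E (x n))
    fun f => by
      obtain ⟨C, hC⟩ := (h f).norm.bddAbove_range
      exact ⟨C, fun n => hC ⟨n, rfl⟩⟩
  refine ⟨M, fun n => ?_⟩
  have := (NormedSpace.inclusionInDoubleDualLi ℝ (E := E)).norm_map (x n)
  rw [← this]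
  exact hM n

section

variable {N : ℕ} {s : ℝ} {p : ℝ≥0∞} [Fact (1 ≤ p)]

theorem Sobolev.norm_toLp_le (u : Sobolev N s p) : ‖Sobolev.toLp u‖ ≤ ‖u‖ :=
  WithLp.norm_fst_le (x := Sobolev.graph u)

theorem Sobolev.norm_le (u : Sobolev N s p) : ‖u‖ ≤ ‖Sobolev.toLp u‖ + ‖Sobolev.D u‖ := by
  have h : Sobolev.graph u = WithLp.toLp p (Sobolev.toLp u, 0) + WithLp.toLp p (0, Sobolev.D u) := by
    apply (WithLp.linearEquiv p ℝ _).injective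
    change (Sobolev.toLp u, Sobolev.D u) = (Sobolev.toLp u + 0, 0 + Sobolev.D u)
    simp
  calc ‖u‖ = ‖Sobolev.graph u‖ := rfl
    _ ≤ _ := by
      rw [h]
      refine (norm_add_le _ _).trans ?_
      rw [WithLp.norm_toLp_fst, WithLp.norm_toLp_snd]

/-- The inclusion `W^{s,p}(ℝ^N) → L^p(ℝ^N)` as a continuous linear map. -/
noncomputable def Sobolev.toLpL : Sobolev N s p →L[ℝ] Lp ℝ p (volume : Measure (Eu N)) :=
  LinearMap.mkContinuous Sobolev.toLp 1 fun u => by simpa using Sobolev.norm_toLp_le u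

theorem Sobolev.eLpNorm_sgrad (u : Sobolev N s p) :
    eLpNorm (sgrad N s p (Sobolev.toLp u)) p volume = ‖Sobolev.D u‖ₑ := by
  rw [Lp.enorm_def]
  exact eLpNorm_congr_ae (Sobolev.coeFn_D u).symm

theorem measurable_average {ε : ℝ} (hε : 0 < ε) {u : Eu N → ℝ} (hu : Measurable u) :
    Measurable fun x => ∫ h, u (x + h) ∂unifBall N ε := by
  have := isProbabilityMeasure_unifBall (N := N) hε
  have h2 : StronglyMeasurable (Function.uncurry fun x h : Eu N => u (x + h)) :=
    (hu.comp (by fun_prop : Measurable fun z : Eu N × Eu N => z.1 + z.2)).stronglyMeasurable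
  exact h2.integral_prod_right.measurable

/-- Averages of a weakly null sequence tend to zero in `L^p` on sets of finite measure. -/
theorem tendsto_eLpNorm_average (hp : p ≠ ⊤) {w : ℕ → Sobolev N s p} {M : ℝ}
    (hM : ∀ n, ‖w n‖ ≤ M) (hw : ∀ f : SobolevDual N s p, Tendsto (fun n => f (w n)) atTop (𝓝 0))
    {K : Set (Eu N)} (hK : volume K ≠ ⊤) {ε : ℝ} (hε : 0 < ε) :
    Tendsto (fun n => eLpNorm (fun x => ∫ h, Sobolev.toLp (w n) (x + h) ∂unifBall N ε) p
      (volume.restrict K)) atTop (𝓝 0) := by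
  have hp1 : (1 : ℝ≥0∞) ≤ p := Fact.out
  have hpr := one_le_toReal hp1 hp
  set c := (volume (Metric.ball (0 : Eu N) ε))⁻¹ ^ (1 / p).toReal with hc
  have hcf : c ≠ ⊤ := (ENNReal.rpow_lt_top_of_nonneg ENNReal.toReal_nonneg
    (ENNReal.inv_ne_top.2 (volume_ball_ne_zero hε))).ne
  have key : Tendsto (fun n => ∫⁻ x in K,
      ‖∫ h, Sobolev.toLp (w n) (x + h) ∂unifBall N ε‖ₑ ^ p.toReal) atTop
      (𝓝 (∫⁻ _ in K, 0)) := by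
    refine tendsto_lintegral_of_dominated_convergence
      (fun _ => (c * ENNReal.ofReal M) ^ p.toReal) (fun n => ?_) (fun n => ae_of_all _ fun x => ?_)
      ?_ (ae_of_all _ fun x => ?_)
    · exact (measurable_average hε (Lp.stronglyMeasurable _).measurable).enorm.pow_const _
    · beta_reduce
      gcongr
      refine (norm_average_le hε hp1 hp (Lp.memLp _) x).trans ?_
      gcongr
      rw [← Lp.enorm_def, ← ofReal_norm]
      exact ENNReal.ofReal_le_ofReal ((Sobolev.norm_toLp_le _).trans (hM n))
    · rw [setLIntegral_const]
      exact ENNReal.mul_ne_top (ENNReal.rpow_ne_top_of_nonneg (by linarith)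
        (ENNReal.mul_ne_top hcf ENNReal.ofReal_ne_top)) hK
    · obtain ⟨T, hT⟩ := exists_clm_average hε hp x
      have h1 := hw (T ∘L Sobolev.toLpL)
      have h2 : Tendsto (fun n => ‖∫ h, Sobolev.toLp (w n) (x + h) ∂unifBall N ε‖ₑ) atTop
          (𝓝 0) := by
        have h3 := h1.enorm
        rw [enorm_zero] at h3
        refine h3.congr fun n => ?_
        rw [← hT]; rfl
      have h4 := h2.ennrpow_const p.toReal
      rwa [ENNReal.zero_rpow_of_pos (by linarith)] at h4
  rw [lintegral_zero] at key
  have h5 := key.ennrpow_const (1 / p.toReal)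
  rw [ENNReal.zero_rpow_of_pos (by positivity)] at h5
  refine h5.congr fun n => ?_
  rw [eLpNorm_eq_lintegral_rpow_enorm_toReal (zero_lt_one.trans_le hp1).ne' hp]

/-- A local Rellich theorem: the embedding of `W^{s,p}(ℝ^N)` in `L^p` of a set of finite measure
maps weakly null sequences to null sequences. -/
theorem tendsto_eLpNorm_restrict (hs : 0 < s) (hp : p ≠ ⊤) {w : ℕ → Sobolev N s p} {M : ℝ}
    (hM : ∀ n, ‖w n‖ ≤ M) (hw : ∀ f : SobolevDual N s p, Tendsto (fun n => f (w n)) atTop (𝓝 0))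
    {K : Set (Eu N)} (hK : volume K ≠ ⊤) :
    Tendsto (fun n => eLpNorm (Sobolev.toLp (w n)) p (volume.restrict K)) atTop (𝓝 0) := by
  have hp1 : (1 : ℝ≥0∞) ≤ p := Fact.out
  have hpr := one_le_toReal hp1 hp
  have hpr0 : 0 < p.toReal := by linarith
  have hlim : Tendsto (fun ε : ℝ => ((ENNReal.ofReal (ε ^ (s * p.toReal)) *
      (volume (Metric.ball (0 : Eu N) 1))⁻¹ * ENNReal.ofReal M ^ p.toReal)) ^ (1 / p.toReal))
      (𝓝[>] 0) (𝓝 0) := by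
    have hsp : 0 < s * p.toReal := by positivity
    have h1 : Tendsto (fun ε : ℝ => ε ^ (s * p.toReal)) (𝓝[>] 0) (𝓝 0) := by
      have := (Real.continuousAt_rpow_const 0 (s * p.toReal) (Or.inr hsp.le)).tendsto
      rw [Real.zero_rpow hsp.ne'] at this
      exact this.mono_left nhdsWithin_le_nhds
    have h2 := ENNReal.tendsto_ofReal h1
    rw [ENNReal.ofReal_zero] at h2
    have h3 := ENNReal.Tendsto.mul_const (b := (volume (Metric.ball (0 : Eu N) 1))⁻¹) h2
      (Or.inr (ENNReal.inv_ne_top.2 (volume_ball_ne_zero one_pos)))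
    have h4 := ENNReal.Tendsto.mul_const (b := ENNReal.ofReal M ^ p.toReal) h3
      (Or.inr (ENNReal.rpow_ne_top_of_nonneg hpr0.le ENNReal.ofReal_ne_top))
    have h5 := h4.ennrpow_const (1 / p.toReal)
    rwa [zero_mul, zero_mul, ENNReal.zero_rpow_of_pos (by positivity)] at h5
  rw [ENNReal.tendsto_nhds_zero]
  intro δ hδ
  have hδ2 : 0 < δ / 2 := ENNReal.half_pos hδ.ne'
  obtain ⟨ε, hε1, hε⟩ := (((ENNReal.tendsto_nhds_zero.1 hlim) _ hδ2).and
    self_mem_nhdsWithin).exists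
  have hε0 : 0 < ε := hε
  filter_upwards [(ENNReal.tendsto_nhds_zero.1
    (tendsto_eLpNorm_average hp hM hw hK hε0)) _ hδ2] with n hn
  have hum : Measurable (Sobolev.toLp (w n) : Eu N → ℝ) := (Lp.stronglyMeasurable _).measurable
  have ham := measurable_average hε0 hum
  have hfirst : eLpNorm (fun x => Sobolev.toLp (w n) x -
      ∫ h, Sobolev.toLp (w n) (x + h) ∂unifBall N ε) p (volume.restrict K) ≤ δ / 2 := by
    refine (eLpNorm_mono_measure _ Measure.restrict_le_self).trans (le_trans ?_ hε1)
    rw [one_div, ENNReal.le_rpow_inv_iff hpr0]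
    refine (eLpNorm_sub_average_rpow_le hs hp1 hp hε0 hum (Lp.memLp _)).trans ?_
    gcongr
    rw [Sobolev.eLpNorm_sgrad, ← ofReal_norm]
    exact ENNReal.ofReal_le_ofReal ((Sobolev.gagliardo_le _).trans (hM n))
  calc _ = eLpNorm ((fun x => Sobolev.toLp (w n) x -
        ∫ h, Sobolev.toLp (w n) (x + h) ∂unifBall N ε) +
        fun x => ∫ h, Sobolev.toLp (w n) (x + h) ∂unifBall N ε) p (volume.restrict K) := by
        congr 1; ext x; simp
    _ ≤ _ := eLpNorm_add_le (hum.sub ham).aestronglyMeasurable ham.aestronglyMeasurable hp1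
    _ ≤ δ / 2 + δ / 2 := add_le_add hfirst hn
    _ = δ := ENNReal.add_halves δ

end

section

variable {N : ℕ} {s : ℝ} {p : ℝ≥0∞}

/-- The kernel `min(1, |w|) / |w|^{N/p+s}`. -/
noncomputable def lipKernel (N : ℕ) (s : ℝ) (p : ℝ≥0∞) (w : Eu N) : ℝ :=
  min 1 ‖w‖ / ‖w‖ ^ ((N : ℝ) / p.toReal + s)

theorem measurable_lipKernel : Measurable (lipKernel N s p) := by
  unfold lipKernel; fun_prop

theorem lipKernel_nonneg (w : Eu N) : 0 ≤ lipKernel N s p w := by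
  unfold lipKernel; positivity

theorem lipKernel_neg (w : Eu N) : lipKernel N s p (-w) = lipKernel N s p w := by
  simp [lipKernel]

theorem memLp_lipKernel [Fact (1 ≤ p)] (hs0 : 0 < s) (hs1 : s < 1) (hp : p ≠ ⊤) :
    MemLp (lipKernel N s p) p volume := by
  have hp1 : (1 : ℝ≥0∞) ≤ p := Fact.out
  have hp0 : p ≠ 0 := (zero_lt_one.trans_le hp1).ne'
  have hpr := one_le_toReal hp1 hp
  rcases Nat.eq_zero_or_pos N with rfl | hN
  · have : lipKernel 0 s p = 0 := by
      ext w
      have hw : w = 0 := Subsingleton.elim _ _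
      simp [lipKernel, hw]
    rw [this]; exact MemLp.zero
  set a : ℝ := (N : ℝ) / p.toReal + s with ha
  have hap : a * p.toReal = N + s * p.toReal := by rw [ha]; field_simp
  have hm := measurable_lipKernel (N := N) (s := s) (p := p)
  have hb : MeasurableSet (Metric.ball (0 : Eu N) 1) := Metric.isOpen_ball.measurableSet
  have h1 : MemLp ((Metric.ball (0 : Eu N) 1).indicator (lipKernel N s p)) p volume := by
    rw [memLp_indicator_iff_restrict hb, ← integrable_norm_rpow_iff hm.aestronglyMeasurable hp0 hp]
    refine integrableOn_ball_of_norm_le_rpow (C := 1) (α := (a - 1) * p.toReal)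
      (by simpa using Nat.one_le_iff_ne_zero.2 hN.ne') ?_ ?_ (hm.norm.pow_const _).aestronglyMeasurable
    · rw [finrank_euclideanSpace_fin, sub_mul, hap]
      nlinarith
    · refine ae_of_all _ fun w => ?_
      rw [one_mul, Real.norm_of_nonneg (by positivity), Real.norm_of_nonneg (lipKernel_nonneg w)]
      rcases eq_or_ne w 0 with rfl | hw
      · have : lipKernel N s p 0 = 0 := by simp [lipKernel]
        rw [this, Real.zero_rpow (by linarith)]
        positivity
      have hn : 0 < ‖w‖ := norm_pos_iff.2 hw
      have : lipKernel N s p w ≤ ‖w‖ ^ (1 - a) := by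
        rw [Real.rpow_sub hn, Real.rpow_one, lipKernel]
        gcongr
        exact min_le_right _ _
      calc _ ≤ (‖w‖ ^ (1 - a)) ^ p.toReal :=
            Real.rpow_le_rpow (lipKernel_nonneg w) this (by linarith)
        _ = _ := by rw [← Real.rpow_mul hn.le]; ring_nf
  have h2 : MemLp ((Metric.ball (0 : Eu N) 1)ᶜ.indicator (lipKernel N s p)) p volume := by
    refine (memLp_truncKernel (N := N) hs0 hp one_pos).mono
      (hm.indicator hb.compl).aestronglyMeasurable (ae_of_all _ fun w => ?_)
    by_cases hw : 1 ≤ ‖w‖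
    · rw [Set.indicator_of_mem (by simpa using hw), truncKernel,
        Set.indicator_of_mem (by exact hw), lipKernel, min_eq_left hw, one_div]
    · rw [Set.indicator_of_notMem (by simpa using hw), norm_zero]
      positivity
  have := h1.add h2
  rwa [Set.indicator_self_add_compl] at this

theorem eLpNorm_mul_comp_sub [Fact (1 ≤ p)] (hp : p ≠ ⊤) {u k : Eu N → ℝ} (hu : Measurable u)
    (hk : Measurable k) :
    eLpNorm (fun z : Eu N × Eu N => u z.1 * k (z.1 - z.2)) p volume =
      eLpNorm u p volume * eLpNorm k p volume := by
  have hp1 : (1 : ℝ≥0∞) ≤ p := Fact.out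
  have hpr := one_le_toReal hp1 hp
  have hpr0 : 0 < p.toReal := by linarith
  refine (ENNReal.rpow_left_injective hpr0.ne') ?_
  simp only
  rw [ENNReal.mul_rpow_of_nonneg _ _ hpr0.le]
  simp_rw [eLpNorm_rpow_toReal hp1 hp, enorm_mul, ENNReal.mul_rpow_of_nonneg _ _ hpr0.le]
  have hm : Measurable fun z : Eu N × Eu N =>
      ‖u z.1‖ₑ ^ p.toReal * ‖k (z.1 - z.2)‖ₑ ^ p.toReal :=
    ((hu.comp measurable_fst).enorm.pow_const _).mul
      ((hk.comp (measurable_fst.sub measurable_snd)).enorm.pow_const _)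
  refine (lintegral_prod _ hm.aemeasurable).trans ?_
  simp only
  have h1 : ∀ x : Eu N, ∫⁻ y, ‖u x‖ₑ ^ p.toReal * ‖k (x - y)‖ₑ ^ p.toReal =
      ‖u x‖ₑ ^ p.toReal * ∫⁻ y, ‖k y‖ₑ ^ p.toReal := fun x => by
    have hx : Measurable fun y => ‖k (x - y)‖ₑ ^ p.toReal :=
      (hk.comp (by fun_prop : Measurable fun y => x - y)).enorm.pow_const _
    rw [lintegral_const_mul _ hx]
    congr 1
    exact lintegral_sub_left_eq_self (fun y => ‖k y‖ₑ ^ p.toReal) x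
  simp_rw [h1]
  rw [lintegral_mul_const _ (hu.enorm.pow_const _)]

/-- The commutator of the `(s,p)`-gradient and multiplication by `η`. -/
noncomputable def sgradCommutator (s : ℝ) (p : ℝ≥0∞) (η : Eu N × Eu N → ℝ) (u : Eu N → ℝ)
    (z : Eu N × Eu N) : ℝ :=
  η z * sgrad N s p u z - sgrad N s p (fun x => η (x, x) * u x) z

theorem commutator_eq (η : Eu N × Eu N → ℝ) (u : Eu N → ℝ) (z : Eu N × Eu N) :
    sgradCommutator s p η u z = ((η z - η (z.1, z.1)) * u z.1 - (η z - η (z.2, z.2)) * u z.2) /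
      ‖z.1 - z.2‖ ^ ((N : ℝ) / p.toReal + s) := by
  simp only [sgradCommutator, sgrad]; ring

theorem commutator_congr (η : Eu N × Eu N → ℝ) {u v : Eu N → ℝ} (h : u =ᵐ[volume] v) :
    sgradCommutator s p η u =ᵐ[volume] sgradCommutator s p η v := by
  have h2 : (fun x => η (x, x) * u x) =ᵐ[volume] fun x => η (x, x) * v x := by
    filter_upwards [h] with x hx; rw [hx]
  filter_upwards [sgrad_congr (s := s) (p := p) h, sgrad_congr (s := s) (p := p) h2] with z h1 h2
  rw [sgradCommutator, h1, h2, sgradCommutator]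

theorem commutator_add (η : Eu N × Eu N → ℝ) (u v : Eu N → ℝ) :
    sgradCommutator s p η (u + v) = sgradCommutator s p η u + sgradCommutator s p η v := by
  ext z; simp only [commutator_eq, Pi.add_apply]; ring

theorem commutator_smul (c : ℝ) (η : Eu N × Eu N → ℝ) (u : Eu N → ℝ) :
    sgradCommutator s p η (c • u) = c • sgradCommutator s p η u := by
  ext z; simp only [commutator_eq, Pi.smul_apply, smul_eq_mul]; ring

/-- Bounds on the difference of a test function and its values on the diagonal. -/
theorem exists_sub_diag_le {η : Eu N × Eu N → ℝ} (hη : ContDiff ℝ ∞ η)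
    (hc : HasCompactSupport η) :
    ∃ C : ℝ, 0 ≤ C ∧ ∃ K : Set (Eu N), IsCompact K ∧ (∀ x, x ∉ K → η (x, x) = 0) ∧
      (∀ z, z.1 ∈ K → |η z - η (z.1, z.1)| ≤ C * min 1 ‖z.1 - z.2‖) ∧
      (∀ z, z.1 ∉ K → η z - η (z.1, z.1) = 0) ∧
      (∀ z, z.2 ∈ K → |η z - η (z.2, z.2)| ≤ C * min 1 ‖z.1 - z.2‖) ∧
      (∀ z, z.2 ∉ K → η z - η (z.2, z.2) = 0) := by
  obtain ⟨L, hL⟩ := ContDiff.lipschitzWith_of_hasCompactSupport hc hη (by simp)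
  obtain ⟨B, hB⟩ := hη.continuous.bounded_above_of_compact_support hc
  have hB0 : 0 ≤ B := (norm_nonneg _).trans (hB 0)
  have hz : ∀ z, z ∉ tsupport η → η z = 0 := fun z hz => image_eq_zero_of_notMem_tsupport hz
  refine ⟨max (2 * B) L, le_max_of_le_left (by positivity),
    Prod.fst '' tsupport η ∪ Prod.snd '' tsupport η,
    (hc.isCompact.image continuous_fst).union (hc.isCompact.image continuous_snd), ?_, ?_, ?_, ?_,
    ?_⟩
  · exact fun x hx => hz _ fun h => hx (Or.inl ⟨_, h, rfl⟩)
  · intro z _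
    rcases min_choice 1 ‖z.1 - z.2‖ with h | h
    · rw [h, mul_one]
      refine le_max_of_le_left ?_
      rw [← Real.norm_eq_abs]
      linarith [norm_sub_le (η z) (η (z.1, z.1)), hB z, hB (z.1, z.1)]
    · rw [h]
      have h1 := hL.norm_sub_le z (z.1, z.1)
      have h2 : ‖z - (z.1, z.1)‖ = ‖z.1 - z.2‖ := by
        simp [Prod.norm_def, norm_sub_rev]
      rw [h2] at h1
      exact h1.trans (by gcongr; exact le_max_right _ _)
  · intro z h
    rw [hz z fun h' => h (Or.inl ⟨_, h', rfl⟩),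
      hz (z.1, z.1) fun h' => h (Or.inl ⟨_, h', rfl⟩), sub_zero]
  · intro z _
    rcases min_choice 1 ‖z.1 - z.2‖ with h | h
    · rw [h, mul_one]
      refine le_max_of_le_left ?_
      rw [← Real.norm_eq_abs]
      linarith [norm_sub_le (η z) (η (z.2, z.2)), hB z, hB (z.2, z.2)]
    · rw [h]
      have h1 := hL.norm_sub_le z (z.2, z.2)
      have h2 : ‖z - (z.2, z.2)‖ = ‖z.1 - z.2‖ := by
        simp [Prod.norm_def]
      rw [h2] at h1
      exact h1.trans (by gcongr; exact le_max_right _ _)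
  · intro z h
    rw [hz z fun h' => h (Or.inr ⟨_, h', rfl⟩),
      hz (z.2, z.2) fun h' => h (Or.inr ⟨_, h', rfl⟩), sub_zero]

/-- The commutator of the `(s,p)`-gradient and multiplication by a test function is an operator of
order zero. -/
theorem exists_eLpNorm_commutator_le [Fact (1 ≤ p)] (hs0 : 0 < s) (hs1 : s < 1) (hp : p ≠ ⊤)
    {η : Eu N × Eu N → ℝ} (hη : ContDiff ℝ ∞ η) (hc : HasCompactSupport η) :
    ∃ A : ℝ≥0∞, A ≠ ⊤ ∧ ∃ K : Set (Eu N), IsCompact K ∧ (∀ x, x ∉ K → η (x, x) = 0) ∧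
      ∀ u : Eu N → ℝ, Measurable u →
        eLpNorm (sgradCommutator s p η u) p volume ≤ A * eLpNorm u p (volume.restrict K) := by
  have hp1 : (1 : ℝ≥0∞) ≤ p := Fact.out
  obtain ⟨C, hC, K, hK, hd, h1, h2, h3, h4⟩ := exists_sub_diag_le hη hc
  have hk := measurable_lipKernel (N := N) (s := s) (p := p)
  refine ⟨2 * ENNReal.ofReal C * eLpNorm (lipKernel N s p) p volume, ENNReal.mul_ne_top
    (ENNReal.mul_ne_top (by simp) ENNReal.ofReal_ne_top)
    (memLp_lipKernel hs0 hs1 hp).2.ne, K, hK, hd, fun u hu => ?_⟩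
  set U := K.indicator u with hU
  have hUm : Measurable U := hu.indicator hK.measurableSet
  set F : Eu N × Eu N → ℝ := fun z => U z.1 * lipKernel N s p (z.1 - z.2) with hF
  have hFm : Measurable F :=
    (hUm.comp measurable_fst).mul (hk.comp (measurable_fst.sub measurable_snd))
  have hsw : MeasurePreserving (Prod.swap : Eu N × Eu N → Eu N × Eu N) volume volume :=
    Measure.measurePreserving_swap
  have hFn : eLpNorm F p volume =
      eLpNorm u p (volume.restrict K) * eLpNorm (lipKernel N s p) p volume := by
    rw [hF, eLpNorm_mul_comp_sub hp hUm hk, hU, eLpNorm_indicator_eq_eLpNorm_restrict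
      hK.measurableSet]
  have hFs : eLpNorm (F ∘ Prod.swap) p volume = eLpNorm F p volume :=
    eLpNorm_comp_measurePreserving hFm.aestronglyMeasurable hsw
  have hb : ∀ z, ‖sgradCommutator s p η u z‖ ≤ C * ‖(|F| + |F ∘ Prod.swap|) z‖ := by
    intro z
    have e1 : |(η z - η (z.1, z.1)) * u z.1| ≤ C * min 1 ‖z.1 - z.2‖ * |U z.1| := by
      by_cases hz : z.1 ∈ K
      · rw [hU, Set.indicator_of_mem hz, abs_mul]
        gcongr
        exact h1 z hz
      · rw [h2 z hz, zero_mul, abs_zero]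
        positivity
    have e2 : |(η z - η (z.2, z.2)) * u z.2| ≤ C * min 1 ‖z.1 - z.2‖ * |U z.2| := by
      by_cases hz : z.2 ∈ K
      · rw [hU, Set.indicator_of_mem hz, abs_mul]
        gcongr
        exact h3 z hz
      · rw [h4 z hz, zero_mul, abs_zero]
        positivity
    have e3 : (|F| + |F ∘ Prod.swap|) z =
        |U z.1| * lipKernel N s p (z.1 - z.2) + |U z.2| * lipKernel N s p (z.1 - z.2) := by
      simp only [hF, Pi.add_apply, Pi.abs_apply, Function.comp_apply, Prod.fst_swap,
        Prod.snd_swap, abs_mul, abs_of_nonneg (lipKernel_nonneg _)]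
      rw [← lipKernel_neg (z.2 - z.1), neg_sub]
    rw [e3, Real.norm_of_nonneg (add_nonneg (mul_nonneg (abs_nonneg _) (lipKernel_nonneg _))
      (mul_nonneg (abs_nonneg _) (lipKernel_nonneg _))), commutator_eq, norm_div,
      Real.norm_of_nonneg (Real.rpow_nonneg (norm_nonneg _) _)]
    calc _ ≤ (C * min 1 ‖z.1 - z.2‖ * |U z.1| + C * min 1 ‖z.1 - z.2‖ * |U z.2|) /
          ‖z.1 - z.2‖ ^ ((N : ℝ) / p.toReal + s) := by
          gcongr
          exact (norm_sub_le _ _).trans (add_le_add e1 e2)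
      _ = _ := by rw [lipKernel]; ring
  refine (eLpNorm_le_mul_eLpNorm_of_ae_le_mul (ae_of_all _ hb) p).trans ?_
  have hs' : Measurable (F ∘ Prod.swap) := hFm.comp measurable_swap
  calc _ ≤ ENNReal.ofReal C * (eLpNorm |F| p volume + eLpNorm |F ∘ Prod.swap| p volume) := by
        gcongr
        exact eLpNorm_add_le hFm.abs.aestronglyMeasurable hs'.abs.aestronglyMeasurable hp1
    _ = ENNReal.ofReal C * (eLpNorm F p volume + eLpNorm F p volume) := by
        rw [← hFs]
        congr 2
        · rw [hFs]; exact eLpNorm_norm F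
        · exact eLpNorm_norm (F ∘ Prod.swap)
    _ = _ := by rw [hFn]; ring

theorem measurable_commutator {η : Eu N × Eu N → ℝ} (hη : Measurable η) {u : Eu N → ℝ}
    (hu : Measurable u) : Measurable (sgradCommutator s p η u) := by
  refine (hη.mul (measurable_sgrad hu)).sub (measurable_sgrad ?_)
  exact (hη.comp (measurable_id.prodMk measurable_id)).mul hu

/-- The commutator as a linear map from `W^{s,p}(ℝ^N)` to `L^p(ℝ^N × ℝ^N)`. -/
theorem exists_linearMap_commutator [Fact (1 ≤ p)] (hs0 : 0 < s) (hs1 : s < 1) (hp : p ≠ ⊤)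
    {η : Eu N × Eu N → ℝ} (hη : ContDiff ℝ ∞ η) (hc : HasCompactSupport η) :
    ∃ R : Sobolev N s p →ₗ[ℝ] LpProd N p, ∀ u, R u =ᵐ[volume] sgradCommutator s p η (Sobolev.toLp u) := by
  obtain ⟨A, hA, K, -, -, h⟩ := exists_eLpNorm_commutator_le hs0 hs1 hp hη hc
  have hm : ∀ u : Sobolev N s p, MemLp (sgradCommutator s p η (Sobolev.toLp u)) p volume := fun u =>
    ⟨(measurable_commutator hη.continuous.measurable
      (Lp.stronglyMeasurable _).measurable).aestronglyMeasurable,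
      (h _ (Lp.stronglyMeasurable _).measurable).trans_lt (ENNReal.mul_lt_top hA.lt_top
        ((eLpNorm_mono_measure _ Measure.restrict_le_self).trans_lt (Lp.memLp _).2))⟩
  refine ⟨{ toFun := fun u => (hm u).toLp, map_add' := fun u v => ?_, map_smul' := fun c u => ?_ },
    fun u => (hm u).coeFn_toLp⟩
  · rw [← MemLp.toLp_add]
    refine MemLp.toLp_congr _ _ ?_
    rw [← commutator_add]
    exact commutator_congr η (Lp.coeFn_add (Sobolev.toLp u) (Sobolev.toLp v))
  · rw [RingHom.id_apply, ← MemLp.toLp_const_smul]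
    refine MemLp.toLp_congr _ _ ?_
    rw [← commutator_smul]
    exact commutator_congr η (Lp.coeFn_smul c (Sobolev.toLp u))

/-- The element of `W^{s,p}(ℝ^N)` represented by a function. -/
noncomputable def Sobolev.ofFun (g : Eu N → ℝ) (hg : MemLp g p volume)
    (hD : MemLp (sgrad N s p g) p volume) : Sobolev N s p :=
  (⟨hg.toLp, (memLp_congr_ae (sgrad_congr hg.coeFn_toLp)).2 hD⟩ : sobolevSubmodule N s p)

theorem Sobolev.coeFn_toLp_ofFun (g : Eu N → ℝ) (hg : MemLp g p volume)
    (hD : MemLp (sgrad N s p g) p volume) :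
    (Sobolev.toLp (Sobolev.ofFun g hg hD) : Eu N → ℝ) =ᵐ[volume] g := hg.coeFn_toLp

theorem Sobolev.coeFn_D_of_ae {u : Sobolev N s p} {g : Eu N → ℝ}
    (h : (Sobolev.toLp u : Eu N → ℝ) =ᵐ[volume] g) :
    (Sobolev.D u : Eu N × Eu N → ℝ) =ᵐ[volume] sgrad N s p g :=
  (Sobolev.coeFn_D u).trans (sgrad_congr h)

/-- Multiplication by the diagonal restriction of a test function is bounded on `W^{s,p}(ℝ^N)`. -/
theorem exists_clm_mul [Fact (1 ≤ p)] (hs0 : 0 < s) (hs1 : s < 1) (hp : p ≠ ⊤)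
    {η : Eu N × Eu N → ℝ} (hη : ContDiff ℝ ∞ η) (hc : HasCompactSupport η) :
    ∃ T : Sobolev N s p →L[ℝ] Sobolev N s p, ∀ u,
      (Sobolev.toLp (T u) : Eu N → ℝ) =ᵐ[volume] fun x => η (x, x) * Sobolev.toLp u x := by
  have hp1 : (1 : ℝ≥0∞) ≤ p := Fact.out
  obtain ⟨A, hA, K, -, -, hcom⟩ := exists_eLpNorm_commutator_le (p := p) hs0 hs1 hp hη hc
  obtain ⟨B, hB⟩ := hη.continuous.bounded_above_of_compact_support hc
  have hB0 : 0 ≤ B := (norm_nonneg _).trans (hB 0)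
  have hum : ∀ u : Sobolev N s p, Measurable (Sobolev.toLp u : Eu N → ℝ) := fun u =>
    (Lp.stronglyMeasurable _).measurable
  have hψ : Measurable fun x : Eu N => η (x, x) :=
    hη.continuous.measurable.comp (measurable_id.prodMk measurable_id)
  have b1 : ∀ u : Sobolev N s p, eLpNorm (fun x => η (x, x) * Sobolev.toLp u x) p volume ≤
      ENNReal.ofReal B * ‖u‖ₑ := fun u => by
    refine (eLpNorm_le_mul_eLpNorm_of_ae_le_mul (g := Sobolev.toLp u) (c := B)
      (ae_of_all _ fun x => ?_) p).trans ?_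
    · rw [norm_mul]; gcongr; exact hB _
    · gcongr
      rw [← Lp.enorm_def, ← ofReal_norm, ← ofReal_norm]
      exact ENNReal.ofReal_le_ofReal (Sobolev.norm_toLp_le u)
  have b2 : ∀ u : Sobolev N s p, eLpNorm (sgrad N s p fun x => η (x, x) * Sobolev.toLp u x) p
      volume ≤ (ENNReal.ofReal B + A) * ‖u‖ₑ := fun u => by
    have e : (sgrad N s p fun x => η (x, x) * Sobolev.toLp u x) =
        (fun z => η z * sgrad N s p (Sobolev.toLp u) z) -
          sgradCommutator s p η (Sobolev.toLp u) := by
      ext z; simp [sgradCommutator]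
    rw [e, add_mul]
    refine (eLpNorm_sub_le (hη.continuous.measurable.mul
      (measurable_sgrad (hum u))).aestronglyMeasurable
      (measurable_commutator hη.continuous.measurable (hum u)).aestronglyMeasurable hp1).trans ?_
    refine add_le_add ?_ ((hcom _ (hum u)).trans ?_)
    · refine (eLpNorm_le_mul_eLpNorm_of_ae_le_mul (g := sgrad N s p (Sobolev.toLp u)) (c := B)
        (ae_of_all _ fun x => ?_) p).trans ?_
      · rw [Pi.mul_apply, norm_mul]; gcongr; exact hB _
      · gcongr
        rw [Sobolev.eLpNorm_sgrad, ← ofReal_norm, ← ofReal_norm]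
        exact ENNReal.ofReal_le_ofReal (Sobolev.gagliardo_le u)
    · gcongr
      refine (eLpNorm_mono_measure _ Measure.restrict_le_self).trans ?_
      rw [← Lp.enorm_def, ← ofReal_norm, ← ofReal_norm]
      exact ENNReal.ofReal_le_ofReal (Sobolev.norm_toLp_le u)
  have hBA : ENNReal.ofReal B + A ≠ ⊤ := ENNReal.add_ne_top.2 ⟨ENNReal.ofReal_ne_top, hA⟩
  have m1 : ∀ u : Sobolev N s p, MemLp (fun x => η (x, x) * Sobolev.toLp u x) p volume := fun u =>
    ⟨(hψ.mul (hum u)).aestronglyMeasurable, (b1 u).trans_lt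
      (ENNReal.mul_lt_top ENNReal.ofReal_lt_top enorm_lt_top)⟩
  have m2 : ∀ u : Sobolev N s p, MemLp (sgrad N s p fun x => η (x, x) * Sobolev.toLp u x) p
      volume := fun u => ⟨(measurable_sgrad (hψ.mul (hum u))).aestronglyMeasurable,
        (b2 u).trans_lt (ENNReal.mul_lt_top hBA.lt_top enorm_lt_top)⟩
  obtain ⟨T, hT⟩ : ∃ T : Sobolev N s p → Sobolev N s p, ∀ u,
      (Sobolev.toLp (T u) : Eu N → ℝ) =ᵐ[volume] fun x => η (x, x) * Sobolev.toLp u x :=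
    ⟨fun u => Sobolev.ofFun _ (m1 u) (m2 u), fun u =>
      Sobolev.coeFn_toLp_ofFun _ (m1 u) (m2 u)⟩
  have hadd : ∀ u v, T (u + v) = T u + T v := by
    intro u v
    apply Sobolev.toLp_injective
    apply Lp.ext
    rw [map_add]
    filter_upwards [hT (u + v), hT u, hT v, Lp.coeFn_add (Sobolev.toLp u) (Sobolev.toLp v),
      Lp.coeFn_add (Sobolev.toLp (T u)) (Sobolev.toLp (T v))] with x h1 h2 h3 h4 h5
    rw [h1, h5, Pi.add_apply, h2, h3, map_add, h4, Pi.add_apply, mul_add]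
  have hsmul : ∀ (c : ℝ) u, T (c • u) = c • T u := by
    intro c u
    apply Sobolev.toLp_injective
    apply Lp.ext
    rw [map_smul]
    filter_upwards [hT (c • u), hT u, Lp.coeFn_smul c (Sobolev.toLp u),
      Lp.coeFn_smul c (Sobolev.toLp (T u))] with x h1 h2 h3 h4
    rw [h1, h4, Pi.smul_apply, h2, map_smul, h3, Pi.smul_apply, smul_eq_mul, smul_eq_mul]
    ring
  have hbd : ∀ u, ‖T u‖ ≤ (B + (B + A.toReal)) * ‖u‖ := by
    intro u
    have c1 : ‖Sobolev.toLp (T u)‖ ≤ B * ‖u‖ := by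
      have := ENNReal.toReal_mono (ENNReal.mul_ne_top ENNReal.ofReal_ne_top enorm_ne_top) (b1 u)
      rw [ENNReal.toReal_mul, ENNReal.toReal_ofReal hB0, toReal_enorm] at this
      rw [Lp.norm_def, eLpNorm_congr_ae (hT u)]
      exact this
    have c2 : ‖Sobolev.D (T u)‖ ≤ (B + A.toReal) * ‖u‖ := by
      have := ENNReal.toReal_mono (ENNReal.mul_ne_top hBA enorm_ne_top) (b2 u)
      rw [ENNReal.toReal_mul, ENNReal.toReal_add ENNReal.ofReal_ne_top hA,
        ENNReal.toReal_ofReal hB0, toReal_enorm] at this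
      rw [Lp.norm_def, eLpNorm_congr_ae (Sobolev.coeFn_D_of_ae (hT u))]
      exact this
    calc ‖T u‖ ≤ _ := Sobolev.norm_le _
      _ ≤ _ := add_le_add c1 c2
      _ = _ := (add_mul B (B + A.toReal) ‖u‖).symm
  exact ⟨LinearMap.mkContinuous { toFun := T, map_add' := hadd, map_smul' := hsmul } _ hbd, hT⟩

end

section

variable {N : ℕ} {s : ℝ} {p : ℝ≥0∞}

theorem eLpNorm_integral_le_of_ae_le {H Z : Type*} [MeasurableSpace H] [MeasurableSpace Z]
    (μ : Measure H) [IsProbabilityMeasure μ] (ν : Measure Z) [SFinite ν]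
    (hp1 : 1 ≤ p) (hp : p ≠ ⊤) {G : H → Z → ℝ} (hG : Measurable (Function.uncurry G)) {c : ℝ≥0∞}
    (hc : ∀ᵐ h ∂μ, eLpNorm (G h) p ν ≤ c) :
    eLpNorm (fun z => ∫ h, G h z ∂μ) p ν ≤ c := by
  have hpr : 0 < p.toReal := by linarith [one_le_toReal hp1 hp]
  rw [← ENNReal.rpow_le_rpow_iff hpr]
  refine (eLpNorm_integral_rpow_le μ ν hp1 hp hG).trans ?_
  calc _ ≤ ∫⁻ _, c ^ p.toReal ∂μ := lintegral_mono_ae (by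
        filter_upwards [hc] with h hh
        gcongr)
    _ = _ := by simp

/-- Translation is continuous in `L^p`. -/
theorem tendsto_eLpNorm_sub_translate {Z : Type*} [NormedAddCommGroup Z] [MeasurableSpace Z]
    [BorelSpace Z] [LocallyCompactSpace Z] [SecondCountableTopology Z] (μ : Measure Z)
    [μ.IsAddHaarMeasure] [Fact (1 ≤ p)] (hp : p ≠ ⊤) {F : Z → ℝ} (hF : MemLp F p μ) :
    Tendsto (fun t : Z => eLpNorm (fun z => F z - F (z - t)) p μ) (𝓝 0) (𝓝 0) := by
  let g : C(Z, C(Z, Z)) := ContinuousMap.curry ⟨fun w : Z × Z => w.2 - w.1, by fun_prop⟩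
  have hgm : ∀ t, MeasurePreserving (g t) μ μ := fun t => measurePreserving_sub_right μ t
  have h1 : Tendsto (fun t => Lp.compMeasurePreserving (g t) (hgm t) (hF.toLp F)) (𝓝 0)
      (𝓝 (Lp.compMeasurePreserving (g 0) (hgm 0) (hF.toLp F))) :=
    tendsto_const_nhds.compMeasurePreservingLp g.continuous.continuousAt hgm (hgm 0) hp
  have h2 := (tendsto_const_nhds (x := hF.toLp F)).sub h1
  have h3 := h2.enorm
  have hcoe : ∀ t, (Lp.compMeasurePreserving (g t) (hgm t) (hF.toLp F) : Z → ℝ) =ᵐ[μ]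
      fun z => F (z - t) := fun t =>
    (Lp.coeFn_compMeasurePreserving _ (hgm t)).trans
      ((hgm t).quasiMeasurePreserving.ae_eq_comp hF.coeFn_toLp)
  have h4 : ∀ t, ‖hF.toLp F - Lp.compMeasurePreserving (g t) (hgm t) (hF.toLp F)‖ₑ =
      eLpNorm (fun z => F z - F (z - t)) p μ := fun t => by
    rw [Lp.enorm_def]
    refine eLpNorm_congr_ae ?_
    filter_upwards [Lp.coeFn_sub (hF.toLp F) (Lp.compMeasurePreserving (g t) (hgm t) (hF.toLp F)),
      hcoe t, hF.coeFn_toLp] with z e1 e2 e3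
    rw [e1, Pi.sub_apply, e2, e3]
  simp only [h4] at h3
  simpa using h3

/-- A compactly supported element of `W^{s,p}(ℝ^N)` is a limit of test functions. -/
theorem mem_sobolevZero [Fact (1 ≤ p)] (hp : p ≠ ⊤) {u : Sobolev N s p} {g : Eu N → ℝ}
    (hg : Measurable g) (hug : (Sobolev.toLp u : Eu N → ℝ) =ᵐ[volume] g) {K Ω : Set (Eu N)}
    (hK : IsCompact K) (hgK : ∀ x, x ∉ K → g x = 0) (hΩ : IsOpen Ω) (hKΩ : K ⊆ Ω) :
    u ∈ sobolevZero Ω := by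
  have hp1 : (1 : ℝ≥0∞) ≤ p := Fact.out
  have hgp : MemLp g p volume := (memLp_congr_ae hug).1 (Lp.memLp _)
  have hDp : MemLp (sgrad N s p g) p volume :=
    (memLp_congr_ae (sgrad_congr hug)).1 (Sobolev.memLp_sgrad u)
  have hgl : LocallyIntegrable g volume := hgp.locallyIntegrable hp1
  obtain ⟨δ, hδ, hδΩ⟩ := hK.exists_cthickening_subset_open hΩ hKΩ
  refine Metric.mem_closure_iff.2 fun r hr => ?_
  have hr3 : 0 < ENNReal.ofReal (r / 3) := ENNReal.ofReal_pos.2 (by positivity)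
  have t1 := (ENNReal.tendsto_nhds_zero.1
    (tendsto_eLpNorm_sub_translate volume hp hgp)) _ hr3
  have hdiag : Tendsto (fun t : Eu N => (t, t)) (𝓝 0) (𝓝 (0 : Eu N × Eu N)) := by
    have : Continuous fun t : Eu N => (t, t) := by fun_prop
    exact this.tendsto 0
  have hhaar : (volume : Measure (Eu N × Eu N)).IsAddHaarMeasure :=
    Measure.prod.instIsAddHaarMeasure volume volume
  have t2 := (ENNReal.tendsto_nhds_zero.1
    ((tendsto_eLpNorm_sub_translate volume hp hDp).comp hdiag)) _ hr3
  obtain ⟨ε₀, hε₀, hball⟩ := Metric.eventually_nhds_iff_ball.1 (t1.and t2)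
  set ε := min ε₀ δ with hε
  have hε0 : 0 < ε := lt_min hε₀ hδ
  let b : ContDiffBump (0 : Eu N) := ⟨ε / 2, ε, by positivity, by linarith⟩
  set ρ : Eu N → ℝ := b.normed volume with hρ
  have hρc : Continuous ρ := b.continuous_normed
  have hρ0 : ∀ t, 0 ≤ ρ t := b.nonneg_normed
  have hρs : HasCompactSupport ρ := b.hasCompactSupport_normed
  have hρi : Integrable ρ volume := b.integrable_normed
  set μ : Measure (Eu N) := volume.withDensity fun t => ENNReal.ofReal (ρ t) with hμ
  have hμp : IsProbabilityMeasure μ := by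
    refine ⟨?_⟩
    rw [hμ, withDensity_apply _ MeasurableSet.univ, Measure.restrict_univ,
      ← ofReal_integral_eq_lintegral_ofReal hρi (ae_of_all _ hρ0), b.integral_normed,
      ENNReal.ofReal_one]
  have hμae : ∀ᵐ t ∂μ, t ∈ Metric.ball (0 : Eu N) ε := by
    rw [hμ, ae_withDensity_iff (hρc.measurable.ennreal_ofReal)]
    refine ae_of_all _ fun t ht => ?_
    have : t ∈ Function.support ρ := fun h => ht (by rw [h, ENNReal.ofReal_zero])
    rwa [hρ, b.support_normed_eq] at this
  have hint : ∀ F : Eu N → ℝ, ∫ t, F t ∂μ = ∫ t, ρ t * F t := fun F => by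
    rw [hμ, integral_withDensity_eq_integral_toReal_smul hρc.measurable.ennreal_ofReal
      (ae_of_all _ fun _ => ENNReal.ofReal_lt_top)]
    refine integral_congr_ae (ae_of_all _ fun t => ?_)
    simp only [ENNReal.toReal_ofReal (hρ0 t), smul_eq_mul]
  have hintg : ∀ x, Integrable (fun t => g (x - t)) μ := fun x => by
    rw [hμ, integrable_withDensity_iff_integrable_smul' hρc.measurable.ennreal_ofReal
      (ae_of_all _ fun _ => ENNReal.ofReal_lt_top)]
    refine (HasCompactSupport.convolutionExists_left (ContinuousLinearMap.lsmul ℝ ℝ) hρs hρc hgl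
      x).congr (ae_of_all _ fun t => ?_)
    simp only [ENNReal.toReal_ofReal (hρ0 t), ContinuousLinearMap.lsmul_apply]
  set gε : Eu N → ℝ := convolution ρ g (ContinuousLinearMap.lsmul ℝ ℝ) volume with hgε
  have hgεx : ∀ x, gε x = ∫ t, g (x - t) ∂μ := fun x => by
    rw [hint]; rfl
  have hdiff : ∀ x, g x - gε x = ∫ t, (g x - g (x - t)) ∂μ := fun x => by
    rw [hgεx, integral_sub (integrable_const _) (hintg x)]
    simp
  have hsubi : ∀ x, Integrable (fun t => g x - g (x - t)) μ := fun x =>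
    (integrable_const _).sub (hintg x)
  have hDdiff : ∀ z, sgrad N s p (g - gε) z =
      ∫ t, (sgrad N s p g z - sgrad N s p g (z - (t, t))) ∂μ := fun z => by
    simp only [sgrad, Pi.sub_apply, Prod.fst_sub, Prod.snd_sub, sub_sub_sub_cancel_right]
    rw [hdiff, hdiff, ← integral_sub (hsubi _) (hsubi _), ← integral_div]
    refine integral_congr_ae (ae_of_all _ fun t => ?_)
    simp only
    ring
  have hsm : ContDiff ℝ ∞ gε :=
    HasCompactSupport.contDiff_convolution_left _ hρs b.contDiff_normed hgl
  have hgs : Function.support g ⊆ K := fun x hx => by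
    by_contra h; exact hx (hgK x h)
  have hsupp : tsupport gε ⊆ Metric.cthickening δ K := by
    refine closure_minimal (fun x hx => ?_) Metric.isClosed_cthickening
    obtain ⟨a, ha, c, hc, rfl⟩ := Set.mem_add.1
      ((support_convolution_subset (ContinuousLinearMap.lsmul ℝ ℝ) (f := ρ) (g := g)) hx)
    rw [hρ, b.support_normed_eq] at ha
    refine Metric.mem_cthickening_of_dist_le _ c _ _ (hgs hc) ?_
    have h1 : ‖a‖ < ε := by simpa using ha
    rw [dist_eq_norm, add_sub_cancel_right]
    exact h1.le.trans (min_le_right _ _)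
  have hcs : HasCompactSupport gε :=
    hK.cthickening.of_isClosed_subset (isClosed_tsupport _) hsupp
  have n1 : eLpNorm (g - gε) p volume ≤ ENNReal.ofReal (r / 3) := by
    have : g - gε = fun x => ∫ t, (g x - g (x - t)) ∂μ := funext hdiff
    rw [this]
    refine eLpNorm_integral_le_of_ae_le μ volume hp1 hp (G := fun t x => g x - g (x - t)) ?_ ?_
    · have m1 : Measurable fun w : Eu N × Eu N => g w.2 := hg.comp measurable_snd
      have m2 : Measurable fun w : Eu N × Eu N => g (w.2 - w.1) := hg.comp (by fun_prop)
      exact m1.sub m2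
    · filter_upwards [hμae] with t ht
      exact (hball t (Metric.ball_subset_ball (min_le_left _ _) ht)).1
  have n2 : eLpNorm (sgrad N s p (g - gε)) p volume ≤ ENNReal.ofReal (r / 3) := by
    have : sgrad N s p (g - gε) =
        fun z => ∫ t, (sgrad N s p g z - sgrad N s p g (z - (t, t))) ∂μ := funext hDdiff
    rw [this]
    refine eLpNorm_integral_le_of_ae_le μ volume hp1 hp
      (G := fun t z => sgrad N s p g z - sgrad N s p g (z - (t, t))) ?_ ?_
    · have m1 : Measurable fun w : Eu N × (Eu N × Eu N) => sgrad N s p g w.2 :=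
        (measurable_sgrad hg).comp measurable_snd
      have m2 : Measurable fun w : Eu N × (Eu N × Eu N) => sgrad N s p g (w.2 - (w.1, w.1)) :=
        (measurable_sgrad hg).comp (by fun_prop)
      exact m1.sub m2
    · filter_upwards [hμae] with t ht
      exact (hball t (Metric.ball_subset_ball (min_le_left _ _) ht)).2
  have hgεm : Measurable gε := hsm.continuous.measurable
  have l1 : MemLp (g - gε) p volume :=
    ⟨(hg.sub hgεm).aestronglyMeasurable, n1.trans_lt ENNReal.ofReal_lt_top⟩
  have l2 : MemLp (sgrad N s p (g - gε)) p volume :=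
    ⟨(measurable_sgrad (hg.sub hgεm)).aestronglyMeasurable, n2.trans_lt ENNReal.ofReal_lt_top⟩
  set w := Sobolev.ofFun (g - gε) l1 l2 with hw
  have hwae := Sobolev.coeFn_toLp_ofFun (g - gε) l1 l2
  refine ⟨u - w, ⟨gε, hsm, hcs, hsupp.trans hδΩ, ?_⟩, ?_⟩
  · rw [map_sub]
    filter_upwards [Lp.coeFn_sub (Sobolev.toLp u) (Sobolev.toLp w), hug, hwae] with x e1 e2 e3
    rw [e1, Pi.sub_apply, e2, hw, e3, Pi.sub_apply, sub_sub_cancel]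
  · rw [dist_eq_norm, sub_sub_cancel]
    have c1 : ‖Sobolev.toLp w‖ ≤ r / 3 := by
      rw [Lp.norm_def, hw, eLpNorm_congr_ae hwae]
      exact ENNReal.toReal_le_of_le_ofReal (by positivity) n1
    have c2 : ‖Sobolev.D w‖ ≤ r / 3 := by
      rw [Lp.norm_def, hw, eLpNorm_congr_ae (Sobolev.coeFn_D_of_ae hwae)]
      exact ENNReal.toReal_le_of_le_ofReal (by positivity) n2
    linarith [Sobolev.norm_le w]

end

section

variable {N : ℕ} {s : ℝ} {p q : ℝ≥0∞} [Fact (1 ≤ p)]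

/-- The duality pairing of `L^p(ℝ^N × ℝ^N)` and `L^{p'}(ℝ^N × ℝ^N)`. -/
noncomputable def pairing (N : ℕ) (p q : ℝ≥0∞) [Fact (1 ≤ p)] [Fact (1 ≤ q)]
    [p.HolderConjugate q] : LpProd N p →L[ℝ] LpProd N q →L[ℝ] ℝ :=
  (ContinuousLinearMap.mul ℝ ℝ).lpPairing volume p q

theorem pairing_apply [Fact (1 ≤ q)] [p.HolderConjugate q] (F : LpProd N p) (φ : LpProd N q) :
    pairing N p q F φ = ∫ z, F z * φ z := by
  rw [pairing, ContinuousLinearMap.lpPairing_eq_integral]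
  rfl

/-- The `(s,p)`-divergence is the adjoint of the `(s,p)`-gradient. -/
theorem spDiv_apply [Fact (1 ≤ q)] [p.HolderConjugate q] (hs : 0 < s) (hp : p ≠ ⊤)
    (φ : LpProd N q) (u : Sobolev N s p) : spDiv hs hp φ u = pairing N p q (Sobolev.D u) φ := by
  have hval : pairing N p q (Sobolev.D u) φ = ∫ z, φ z * sgrad N s p (Sobolev.toLp u) z := by
    rw [pairing_apply]
    refine integral_congr_ae ?_
    filter_upwards [Sobolev.coeFn_D u] with z hz
    rw [hz, mul_comm]
  rw [hval]
  refine tendsto_nhds_unique (spDiv_spec hs hp φ u) ?_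
  have hφ := Lp.memLp φ
  have hI : Integrable (fun z => φ z * sgrad N s p (Sobolev.toLp u) z) volume :=
    ((Sobolev.memLp_sgrad u).integrable_mul hφ).congr (ae_of_all _ fun z => mul_comm _ _)
  have hlim : Tendsto (fun ε : ℝ => ∫ z, Set.indicator {z : Eu N × Eu N | ε ≤ ‖z.1 - z.2‖}
        (fun z => φ z * sgrad N s p (Sobolev.toLp u) z) z) (𝓝[>] 0)
      (𝓝 (∫ z, φ z * sgrad N s p (Sobolev.toLp u) z)) := by
    refine tendsto_integral_filter_of_dominated_convergence
      (fun z => ‖φ z * sgrad N s p (Sobolev.toLp u) z‖) ?_ ?_ hI.norm ?_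
    · exact Eventually.of_forall fun ε =>
        hI.aestronglyMeasurable.indicator (measurableSet_le measurable_const (by fun_prop))
    · exact Eventually.of_forall fun ε => ae_of_all _ fun z => norm_indicator_le_norm_self _ _
    · refine ae_of_all _ fun z => tendsto_const_nhds.congr' ?_
      by_cases hz : z.1 = z.2
      · refine Eventually.of_forall fun ε => ?_
        simp [Set.indicator, sgrad, hz]
      · have hpos : 0 < ‖z.1 - z.2‖ := norm_pos_iff.2 (sub_ne_zero.2 hz)
        filter_upwards [Ioo_mem_nhdsGT hpos] with ε hε
        rw [Set.indicator_of_mem]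
        exact hε.2.le
  refine hlim.congr' ?_
  filter_upwards [self_mem_nhdsWithin] with ε hε
  exact (integral_truncDiv_mul hs hp hε hφ (Lp.memLp (Sobolev.toLp u))).symm

theorem smul_mem_sobolevZero {Ω : Set (Eu N)} {u : Sobolev N s p} (hu : u ∈ sobolevZero Ω)
    (c : ℝ) : c • u ∈ sobolevZero Ω := by
  refine map_mem_closure (continuous_const_smul c) hu ?_
  rintro v ⟨g, hg, hc, hΩ, hv⟩
  refine ⟨c • g, contDiff_const.smul hg, hc.smul_left (f := fun _ => c),
    (tsupport_smul_subset_right (fun _ => c) g).trans hΩ, ?_⟩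
  rw [map_smul]
  filter_upwards [Lp.coeFn_smul c (Sobolev.toLp v), hv] with x h1 h2
  rw [h1, Pi.smul_apply, h2, Pi.smul_apply]

theorem ofReal_le_dualNormOn_mul {Ω : Set (Eu N)} {f : SobolevDual N s p}
    (hf : ∀ u, Sobolev.gagliardo u = 0 → f u = 0) {u : Sobolev N s p} (hu : u ∈ sobolevZero Ω) :
    ENNReal.ofReal (f u) ≤ dualNormOn Ω f * ENNReal.ofReal u.gagliardo := by
  by_cases h0 : u.gagliardo = 0
  · rw [hf u h0]; simp
  have hnn : 0 ≤ u.gagliardo := norm_nonneg _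
  have h1 : (u.gagliardo⁻¹ • u).gagliardo = 1 := by
    rw [Sobolev.gagliardo, map_smul, norm_smul, norm_inv, Real.norm_of_nonneg hnn]
    exact inv_mul_cancel₀ h0
  have h2 : f u = f (u.gagliardo⁻¹ • u) * u.gagliardo := by
    rw [map_smul, smul_eq_mul]; field_simp
  rw [h2, ENNReal.ofReal_mul' hnn]
  gcongr
  exact le_iSup_of_le (u.gagliardo⁻¹ • u)
    (le_iSup₂_of_le (smul_mem_sobolevZero hu _) h1 le_rfl)

theorem enorm_le_dualNormOn_mul {Ω : Set (Eu N)} {f : SobolevDual N s p}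
    (hf : ∀ u, Sobolev.gagliardo u = 0 → f u = 0) {u : Sobolev N s p} (hu : u ∈ sobolevZero Ω) :
    ‖f u‖ₑ ≤ dualNormOn Ω f * ENNReal.ofReal u.gagliardo := by
  rw [← ofReal_norm, Real.norm_eq_abs]
  rcases abs_choice (f u) with h | h
  · rw [h]; exact ofReal_le_dualNormOn_mul hf hu
  · have h1 := ofReal_le_dualNormOn_mul hf (smul_mem_sobolevZero hu (-1))
    have h2 : ((-1 : ℝ) • u).gagliardo = u.gagliardo := by
      rw [Sobolev.gagliardo, map_smul, norm_smul]; simp [Sobolev.gagliardo]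
    rw [h2, map_smul, smul_eq_mul, neg_one_mul] at h1
    rwa [h]

theorem tendsto_spDiv_apply [Fact (1 ≤ q)] [p.HolderConjugate q] (hs : 0 < s) (hp : p ≠ ⊤)
    {φ : ℕ → LpProd N q} {φ₀ : LpProd N q}
    (hdiv : TendstoDualLoc (fun n => (spDiv hs hp (φ n) : SobolevDual N s p)) (spDiv hs hp φ₀))
    {Ω : Set (Eu N)} (hΩ : IsOpen Ω) (hb : Bornology.IsBounded Ω) {u : ℕ → Sobolev N s p}
    {u₀ : Sobolev N s p} (hu : ∀ n, u n ∈ sobolevZero Ω)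
    (huw : ∀ f : SobolevDual N s p, Tendsto (fun n => f (u n)) atTop (𝓝 (f u₀))) :
    Tendsto (fun n => spDiv hs hp (φ n) (u n)) atTop (𝓝 (spDiv hs hp φ₀ u₀)) := by
  obtain ⟨M, hM⟩ := exists_norm_le_of_tendsto_dual huw
  have h1 : Tendsto (fun n => (spDiv hs hp (φ n) - spDiv hs hp φ₀ : SobolevDual N s p) (u n))
      atTop (𝓝 0) := by
    rw [tendsto_iff_enorm_sub_tendsto_zero]
    have h2 := ENNReal.Tendsto.mul_const (b := ENNReal.ofReal M) (hdiv Ω hΩ hb)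
      (Or.inr ENNReal.ofReal_ne_top)
    rw [zero_mul] at h2
    refine tendsto_of_tendsto_of_tendsto_of_le_of_le tendsto_const_nhds h2
      (fun _ => zero_le) fun n => ?_
    rw [sub_zero]
    refine (enorm_le_dualNormOn_mul (fun w hw => ?_) (hu n)).trans ?_
    · have hD : Sobolev.D w = 0 := norm_eq_zero.1 hw
      rw [sub_apply, spDiv_apply, spDiv_apply, hD, map_zero]
      simp
    · gcongr
      exact (Sobolev.gagliardo_le _).trans (hM n)
  have h3 := h1.add (huw (spDiv hs hp φ₀))
  rw [zero_add] at h3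
  refine h3.congr fun n => ?_
  rw [sub_apply, sub_add_cancel]

end

end NonlocalDivCurl

open NonlocalDivCurl in
theorem mainTheorem2 (N : ℕ) (s : ℝ) (hs0 : 0 < s) (hs1 : s < 1)
    (p q : ℝ≥0∞) [Fact (1 ≤ p)] [Fact (1 ≤ q)] (hp : p ≠ ⊤) [p.HolderConjugate q]
    (φ : ℕ → NonlocalDivCurl.LpProd N q) (φ₀ : NonlocalDivCurl.LpProd N q)
    (v : ℕ → NonlocalDivCurl.Sobolev N s p) (v₀ : NonlocalDivCurl.Sobolev N s p)
    (hv : Tendsto (fun n => toWeakSpace ℝ (NonlocalDivCurl.Sobolev N s p) (v n)) atTop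
      (𝓝 (toWeakSpace ℝ (NonlocalDivCurl.Sobolev N s p) v₀)))
    (hφ : Tendsto (fun n => toWeakSpace ℝ (NonlocalDivCurl.LpProd N q) (φ n)) atTop
      (𝓝 (toWeakSpace ℝ (NonlocalDivCurl.LpProd N q) φ₀)))
    (hdiv : NonlocalDivCurl.TendstoDualLoc
      (fun n => (NonlocalDivCurl.spDiv hs0 hp (φ n) : NonlocalDivCurl.SobolevDual N s p))
      (NonlocalDivCurl.spDiv hs0 hp φ₀)) :
    ∀ η : NonlocalDivCurl.Eu N × NonlocalDivCurl.Eu N → ℝ,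
      ContDiff ℝ ∞ η → HasCompactSupport η →
      Tendsto (fun n => ∫ z, φ n z * NonlocalDivCurl.sgrad N s p (v n).toLp z * η z) atTop
        (𝓝 (∫ z, φ₀ z * NonlocalDivCurl.sgrad N s p v₀.toLp z * η z)) := by
  intro η hη hc
  have hvw := tendsto_dual_of_tendsto_weak hv
  have hφw := tendsto_dual_of_tendsto_weak hφ
  obtain ⟨Mφ, hMφ⟩ := exists_norm_le_of_tendsto_dual hφw
  obtain ⟨T, hT⟩ := exists_clm_mul (p := p) hs0 hs1 hp hη hc
  obtain ⟨R, hR⟩ := exists_linearMap_commutator (p := p) hs0 hs1 hp hη hc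
  obtain ⟨A, hA, K, hK, hηK, hcom⟩ := exists_eLpNorm_commutator_le (p := p) hs0 hs1 hp hη hc
  have hum : ∀ u : Sobolev N s p, Measurable (Sobolev.toLp u : Eu N → ℝ) := fun u =>
    (Lp.stronglyMeasurable _).measurable
  have hsplit : ∀ (ψ : LpProd N q) (u : Sobolev N s p),
      ∫ z, ψ z * sgrad N s p (Sobolev.toLp u) z * η z =
        spDiv hs0 hp ψ (T u) + pairing N p q (R u) ψ := fun ψ u => by
    rw [spDiv_apply, ← add_apply, ← map_add, pairing_apply]
    refine integral_congr_ae ?_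
    filter_upwards [Lp.coeFn_add (Sobolev.D (T u)) (R u), Sobolev.coeFn_D_of_ae (hT u), hR u]
      with z h1 h2 h3
    rw [h1, Pi.add_apply, h2, h3, sgradCommutator]
    ring
  simp only [hsplit]
  obtain ⟨r, hr⟩ := hK.isBounded.subset_ball 0
  refine (tendsto_spDiv_apply hs0 hp hdiv (Metric.isOpen_ball (x := (0 : Eu N)) (ε := r))
    Metric.isBounded_ball (fun n => ?_) (fun f => hvw (f ∘L T))).add ?_
  · have hψ : Measurable fun x : Eu N => η (x, x) :=
      hη.continuous.measurable.comp (measurable_id.prodMk measurable_id)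
    refine mem_sobolevZero hp (hψ.mul (hum (v n))) (hT (v n)) hK (fun x hx => ?_)
      Metric.isOpen_ball hr
    rw [Pi.mul_apply, hηK x hx, zero_mul]
  · have hw0 : ∀ f : SobolevDual N s p, Tendsto (fun n => f (v n - v₀)) atTop (𝓝 0) := fun f => by
      simpa using (hvw f).sub_const (f v₀)
    obtain ⟨M, hM⟩ := exists_norm_le_of_tendsto_dual (x := fun n => v n - v₀) (x₀ := 0)
      fun f => by simpa only [map_zero] using hw0 f
    have hRe : Tendsto (fun n => ‖R (v n - v₀)‖ₑ) atTop (𝓝 0) := by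
      have h1 := ENNReal.Tendsto.const_mul (a := A)
        (tendsto_eLpNorm_restrict hs0 hp hM hw0 hK.measure_ne_top) (Or.inr hA)
      rw [mul_zero] at h1
      refine tendsto_of_tendsto_of_tendsto_of_le_of_le tendsto_const_nhds h1
        (fun _ => zero_le) fun n => ?_
      rw [Lp.enorm_def, eLpNorm_congr_ae (hR _)]
      exact hcom _ (hum _)
    have hRn : Tendsto (fun n => ‖R (v n - v₀)‖) atTop (𝓝 0) := by
      have := (ENNReal.tendsto_toReal ENNReal.zero_ne_top).comp hRe
      simpa [Function.comp_def] using this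
    have h1 : Tendsto (fun n => pairing N p q (R (v n - v₀)) (φ n)) atTop (𝓝 0) := by
      have h2 := (hRn.const_mul ‖pairing N p q‖).mul_const Mφ
      rw [mul_zero, zero_mul] at h2
      refine squeeze_zero_norm (fun n => ?_) h2
      refine ((pairing N p q).le_opNorm₂ _ _).trans ?_
      gcongr
      exact hMφ n
    have h3 := h1.add (hφw (pairing N p q (R v₀)))
    rw [zero_add] at h3
    refine h3.congr fun n => ?_
    rw [map_sub, map_sub, sub_apply, sub_add_cancel]
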